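/- \textbf{Model.} Parameters: $\lambda_B,\lambda_D>0$ (densities of base stations (BSs) and of users (UEs) in $\mathbb R^2$), packet arrival probability $p_a\in[0,1]$, number of pilots $S\ge 1$, $\lambda_a=p_a\lambda_D/S$, path-loss exponent $\alpha=4$, received-power target $\rho>0$, noise power $\sigma^2\ge 0$, SINR threshold $\gamma_{\rm th}>0$, power level units $g_m>0$ ($m\ge1$), $c=3.575$. A typical BS sits at the origin. In the $m$-th round trip of the Reactive scheme a UE is active with probability $\mathcal A_m$, where $\mathcal A_1=1$, $\mathcal A_m=1-\sum_{i=1}^{m-1}\mathcal A_i\mathcal P_i$ for $m\ge 2$, and $\mathcal P_i$ is the access success probability in round trip $i$, defined below. Round trip $m$ is described by the following random objects. (1) The area of the typical Voronoi cell, in units of $1/\lambda_B$, is approximated by the Gamma law of shape and rate $c$; the area $X$ of the cell of the typical UE, in the same units, has the size-biased version of this law. Given $X$, the number $N$ of other active UEs of the cell using the same pilot is Poisson with mean $\mathcal A_m\lambda_a X/\lambda_B$. The typical UE is UE $0$ and the others are the UEs $1,\dots,N$. (2) UE $j$ is received by the typical BS with $$\mathrm{SINR}_{m,j}=\frac{g_m\rho\,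 h_{j,j}}{\sum_{k\in\{0,\dots,N\}\setminus\{j\}} g_m\rho\, h_{j,k}+\mathcal I_j+\sigma^2},\qquad \mathcal I_j=\sum_{i:\ R_{j,i}<\|u_{j,i}\|} g_m\,\rho R_{j,i}^{\alpha}\, q_{j,i}\,\|u_{j,i}\|^{-\alpha},$$ where the $h_{j,k}$ and $q_{j,i}$ are exponential with mean $1$ (Rayleigh fading), the points $u_{j,i}$ form a homogeneous Poisson process on $\mathbb R^2$ of intensity $\mathcal A_m\lambda_a$, and $R_{j,i}$ is the distance from $u_{j,i}$ to the nearest point of a Poisson process of BSs of intensity $\lambda_B$ (so that $\rho R_{j,i}^\alpha$ is the transmit power under full path-loss inversion, and a UE interferes from another cell exactly if it has a BS nearer than the typical one). (3) All these objects are independent of each other, except $N$ and $X$: in particular the BS processes seen by different interferers, and all objects belonging to the receptions of different UEs $j$, are treated as independent. UE $j$ is received if $\mathrm{SINR}_{m,j}\ge\gamma_{\rm th}$. There is no collision if none of the UEs $1,\dots,N$ is received. Access of the typical UE succeeds if UE $0$ is received and there is no collision, and $\mathcal P_m$ is the probability of this event. \textbf{Lemma 1.} For every $m\ge 1$ and $n\ge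 0$ put $$\mathrm O[n,m]=\frac{c^{c+1}\,\Gamma(n+c+1)\,(\mathcal A_m\lambda_a/\lambda_B)^n}{\Gamma(c+1)\,\Gamma(n+1)\,(\mathcal A_m\lambda_a/\lambda_B+c)^{n+c+1}},$$ $$\Theta[n,m]=\exp\Big(-\frac{\gamma_{\rm th}\sigma^2}{g_m\rho}\Big)(1+\gamma_{\rm th})^{-n}\exp\Big(-\sqrt{\gamma_{\rm th}}\,\frac{\mathcal A_m\lambda_a}{\lambda_B}\arctan\sqrt{\gamma_{\rm th}}\Big).$$ Then (I) $\mathbb P(N=n)=\mathrm O[n,m]$ for every $n\ge 0$; (II) if $\mathbb P(N=n)>0$, then $\mathbb P(\mathrm{SINR}_{m,0}\ge\gamma_{\rm th}\mid N=n)=\Theta[n,m]$; (III) if $\mathbb P(N=n)>0$, then the conditional probability of no collision, given $N=n$, is $(1-\Theta[n,m])^n$; and the access success probability of the typical UE in the $m$-th round trip is $$\mathcal P_m=\sum_{n=0}^\infty \mathrm O[n,m]\,\Theta[n,m]\,\big(1-\Theta[n,m]\big)^n .$$ -/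

import Mathlib

open MeasureTheory ProbabilityTheory
open scoped ENNReal NNReal

noncomputable section

namespace GrantFree

/-- The plane in which base stations (BSs) and user equipments (UEs) are placed. -/
abbrev Plane : Type := EuclideanSpace ℝ (Fin 2)

/-- The constant of the gamma approximation of the area of a planar Poisson-Voronoi cell. -/
def voronoiC : ℝ := 3.575

/-- The parameters of the network. -/
structure Params where
  /-- intensity of the base stations -/
  lamB : ℝ
  /-- intensity of the UEs -/
  lamD : ℝ
  /-- packet arrival probability -/
  pa : ℝ
  /-- number of orthogonal pilots -/
  S : ℕ
  /-- path-loss exponent -/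
  alpha : ℝ
  /-- target received power of the full path-loss inversion power control -/
  rho : ℝ
  /-- noise power -/
  sigmaSq : ℝ
  /-- SINR threshold -/
  gammaTh : ℝ
  /-- power level unit of each round trip (round trips are numbered from `1`) -/
  g : ℕ → ℝ
  lamB_pos : 0 < lamB
  lamD_pos : 0 < lamD
  pa_nonneg : 0 ≤ pa
  pa_le_one : pa ≤ 1
  S_pos : 0 < S
  rho_pos : 0 < rho
  sigmaSq_nonneg : 0 ≤ sigmaSq
  gammaTh_pos : 0 < gammaTh
  g_pos : ∀ m, 1 ≤ m → 0 < g m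

/-- Density of the UEs that have a packet and choose a given pilot. -/
def Params.lamA (p : Params) : ℝ := p.pa * p.lamD / p.S

section PointProcesses

variable {Ω : Type*} [MeasurableSpace Ω]

/-- The random counting measure `Φ` is a Poisson point process with intensity measure `Λ`:
Poisson counts on sets of finite intensity, and independent counts on disjoint sets. -/
structure IsPoissonProcess (μ : Measure Ω) (Φ : Ω → Measure Plane) (Λ : Measure Plane) :
    Prop where
  measurable : Measurable Φ
  count_law : ∀ B : Set Plane, MeasurableSet B → Λ B ≠ ∞ → ∀ n : ℕ,
    μ {ω | Φ ω B = n} = poissonMeasure (Λ B).toNNReal {n}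
  count_indep : ∀ B : ℕ → Set Plane, (∀ i, MeasurableSet (B i)) →
    Pairwise (fun i j => Disjoint (B i) (B j)) → iIndepFun (fun i ω => Φ ω (B i)) μ

/-- The counting measure of the points `x 0, x 1, …, x (K - 1)` (all `x i` if `K = ∞`). -/
def countingMeasure (K : ℕ∞) (x : ℕ → Plane) : Measure Plane :=
  Measure.sum fun i : ℕ => if (i : ℕ∞) < K then Measure.dirac (x i) else 0

/-- Distance from the origin to the nearest point of a point configuration. -/
def nearestDist (Φ : Measure Plane) : ℝ :=
  sInf {r : ℝ | 0 ≤ r ∧ Φ (Metric.closedBall 0 r) ≠ 0}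

/-- The size-biased version of a law on `[0, ∞)`: density proportional to `x`. If `ν` is the law
of the area of the typical cell, this is the law of the area of the cell that contains the
typical UE. -/
def sizeBiased (ν : Measure ℝ) : Measure ℝ :=
  (∫⁻ x, ENNReal.ofReal x ∂ν)⁻¹ • ν.withDensity ENNReal.ofReal

end PointProcesses

/-- The random objects of one round trip, on one pilot. UE `0` is the typical UE; the UEs
`1, …, N` are the other active UEs of its cell that use the same pilot. For each UE `j`, "the
reception of UE `j`" is the attempt of the typical BS, which sits at the origin, to decode UE
`j`. As usual in this approximate analysis, different receptions are decoupled: each has its own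
channel gains and its own inter-cell interferers. -/
structure Round (Ω : Type*) where
  /-- area of the cell of the typical UE -/
  area : Ω → ℝ
  /-- number of intra-cell interfering UEs -/
  N : Ω → ℕ
  /-- `gain j k`: power gain of the channel from UE `k` of the cell, in the reception of UE `j` -/
  gain : ℕ → ℕ → Ω → ℝ
  /-- number of the active UEs in the plane, in the reception of UE `j` -/
  K : ℕ → Ω → ℕ∞
  /-- locations of these UEs -/
  loc : ℕ → ℕ → Ω → Plane
  /-- BSs other than the typical one, in coordinates centred at the UE `loc j i` -/
  bs : ℕ → ℕ → Ω → Measure Plane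
  /-- power gain of the channel from the UE `loc j i` to the typical BS -/
  interGain : ℕ → ℕ → Ω → ℝ

/-- Labels of the independent sources of randomness of a round trip. -/
inductive Source where
  | cell : Source
  | gain (j k : ℕ) : Source
  | field (j : ℕ) : Source
  | bs (j i : ℕ) : Source
  | interGain (j i : ℕ) : Source

namespace Round

variable {Ω : Type*}

/-- The σ-algebra generated by each source of randomness. -/
@[reducible] def sigma (R : Round Ω) : Source → MeasurableSpace Ω
  | .cell => MeasurableSpace.comap R.area inferInstance ⊔ MeasurableSpace.comap R.N inferInstance
  | .gain j k => MeasurableSpace.comap (R.gain j k) inferInstance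
  | .field j => MeasurableSpace.comap (R.K j) inferInstance ⊔
      ⨆ i, MeasurableSpace.comap (R.loc j i) inferInstance
  | .bs j i => MeasurableSpace.comap (R.bs j i) inferInstance
  | .interGain j i => MeasurableSpace.comap (R.interGain j i) inferInstance

/-- Distance of the UE `loc j i` to the nearest BS other than the typical one. -/
def linkDist (R : Round Ω) (j i : ℕ) (ω : Ω) : ℝ := nearestDist (R.bs j i ω)

/-- Transmit power (at unit power level) of the UE `loc j i` when it is served by its nearest BS
other than the typical one: full path-loss inversion. -/
def transmitPower (R : Round Ω) (p : Params) (j i : ℕ) (ω : Ω) : ℝ :=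
  p.rho * R.linkDist j i ω ^ p.alpha

/-- Intra-cell interference in the reception of UE `j`: each of the other UEs of the cell is
received with mean power `g * ρ`. -/
def intra (R : Round Ω) (p : Params) (g : ℝ) (j : ℕ) (ω : Ω) : ℝ≥0∞ :=
  ∑ k ∈ (Finset.range (R.N ω + 1)).erase j, ENNReal.ofReal (g * p.rho * R.gain j k ω)

/-- Inter-cell interference in the reception of UE `j`. The UE `loc j i` contributes if and only
if it belongs to another cell, i.e. some other BS is nearer to it than the typical BS at `0`. -/
def inter (R : Round Ω) (p : Params) (g : ℝ) (j : ℕ) (ω : Ω) : ℝ≥0∞ :=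
  ∑' i : ℕ,
    if (i : ℕ∞) < R.K j ω ∧ R.linkDist j i ω < ‖R.loc j i ω‖ then
      ENNReal.ofReal
        (g * R.transmitPower p j i ω * R.interGain j i ω * ‖R.loc j i ω‖ ^ (-p.alpha))
    else 0

/-- The SINR of UE `j` at the typical BS (infinite if there is neither noise nor interference). -/
def sinr (R : Round Ω) (p : Params) (g : ℝ) (j : ℕ) (ω : Ω) : ℝ≥0∞ :=
  ENNReal.ofReal (g * p.rho * R.gain j j ω) /
    (R.intra p g j ω + R.inter p g j ω + ENNReal.ofReal p.sigmaSq)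

/-- The signal of UE `j` is successfully received by the typical BS. -/
def received (R : Round Ω) (p : Params) (g : ℝ) (j : ℕ) : Set Ω :=
  {ω | ENNReal.ofReal p.gammaTh ≤ R.sinr p g j ω}

/-- No collision: none of the intra-cell interfering UEs `1, …, N` is successfully received. -/
def noCollision (R : Round Ω) (p : Params) (g : ℝ) : Set Ω :=
  {ω | ∀ j, 1 ≤ j → j ≤ R.N ω → ω ∉ R.received p g j}

/-- Grant-free access of the typical UE succeeds: it is received, and there is no collision. -/
def access (R : Round Ω) (p : Params) (g : ℝ) : Set Ω :=
  R.received p g 0 ∩ R.noCollision p g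

/-- The law of a round trip in which UEs are still active with probability `a`. -/
structure HasLaw [MeasurableSpace Ω] (R : Round Ω) (p : Params) (a : ℝ) (μ : Measure Ω) :
    Prop where
  measurable_area : Measurable R.area
  measurable_N : Measurable R.N
  measurable_gain : ∀ j k, Measurable (R.gain j k)
  measurable_K : ∀ j, Measurable (R.K j)
  measurable_loc : ∀ j i, Measurable (R.loc j i)
  measurable_bs : ∀ j i, Measurable (R.bs j i)
  measurable_interGain : ∀ j i, Measurable (R.interGain j i)
  /-- The area of the typical cell, in units of its mean `1 / λ_B`, is approximated by the gamma
  law with shape and rate `c`; the cell of the typical UE is size-biased. -/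
  area_law : μ.map (fun ω => p.lamB * R.area ω) = sizeBiased (gammaMeasure voronoiC voronoiC)
  /-- Given the area of the cell, the number of intra-cell interferers is Poisson with mean
  density times area. -/
  count_law : ∀ B : Set ℝ, MeasurableSet B → ∀ n : ℕ,
    μ (R.area ⁻¹' B ∩ R.N ⁻¹' {n}) =
      ∫⁻ x in B, poissonMeasure (Real.toNNReal (a * p.lamA * x)) {n} ∂(μ.map R.area)
  /-- Rayleigh fading. -/
  gain_law : ∀ j k, μ.map (R.gain j k) = expMeasure 1
  /-- The active UEs of the plane on the pilot are a Poisson process. -/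
  field_law : ∀ j, IsPoissonProcess μ (fun ω => countingMeasure (R.K j ω) (fun i => R.loc j i ω))
    (ENNReal.ofReal (a * p.lamA) • volume)
  /-- The BSs are a Poisson process, seen from any UE. -/
  bs_law : ∀ j i, IsPoissonProcess μ (R.bs j i) (ENNReal.ofReal p.lamB • volume)
  /-- Rayleigh fading. -/
  interGain_law : ∀ j i, μ.map (R.interGain j i) = expMeasure 1
  /-- All sources of randomness are independent: the fading, the interferers, and (an
  approximation) the BS environments of different UEs and the receptions of different UEs. -/
  indep : iIndep R.sigma μ

end Round

/-- The probability of being active in round trip `m`, when the access success probabilities of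
the round trips `1, 2, …` are `P 1, P 2, …`. -/
def activeProb (P : ℕ → ℝ) (m : ℕ) : ℝ :=
  1 - ∑ i ∈ (Finset.Ico 1 m).attach, activeProb P i.1 * P i.1
termination_by m
decreasing_by exact (Finset.mem_Ico.mp i.2).2

theorem activeProb_eq (P : ℕ → ℝ) (m : ℕ) :
    activeProb P m = 1 - ∑ i ∈ Finset.Ico 1 m, activeProb P i * P i := by
  rw [activeProb, Finset.sum_attach (Finset.Ico 1 m) (fun i => activeProb P i * P i)]

section Scheme

variable {Ω : Type*} [MeasurableSpace Ω]

/-- Grant-free access success probability of the typical UE in the `m`-th round trip. -/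
def accessProb (μ : Measure Ω) (p : Params) (rounds : ℕ → Round Ω) (m : ℕ) : ℝ :=
  μ.real ((rounds m).access p (p.g m))

/-- Probability that a UE is active in the `m`-th round trip of the Reactive scheme. -/
def reacActive (μ : Measure Ω) (p : Params) (rounds : ℕ → Round Ω) (m : ℕ) : ℝ :=
  activeProb (accessProb μ p rounds) m

/-- The Reactive scheme: in every round trip the network is redrawn, with the UEs that are still
active. -/
def IsReactive (μ : Measure Ω) (p : Params) (rounds : ℕ → Round Ω) : Prop :=
  ∀ m, 1 ≤ m → (rounds m).HasLaw p (reacActive μ p rounds m) μ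

end Scheme

/-- The formula `O[n, m]`, for the activity probability `A`. -/
def pmfO (p : Params) (A : ℝ) (n : ℕ) : ℝ :=
  (voronoiC ^ (voronoiC + 1) * Real.Gamma (n + voronoiC + 1) * (A * p.lamA / p.lamB) ^ n) /
    (Real.Gamma (voronoiC + 1) * Real.Gamma (n + 1) *
      (A * p.lamA / p.lamB + voronoiC) ^ ((n : ℝ) + voronoiC + 1))

/-- The formula `Θ[n, m]`, for the activity probability `A` and the power level unit `g`. -/
def theta (p : Params) (A g : ℝ) (n : ℕ) : ℝ :=
  Real.exp (-(p.gammaTh * p.sigmaSq / (g * p.rho))) * (1 + p.gammaTh) ^ (-(n : ℤ)) *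
    Real.exp (-(Real.sqrt p.gammaTh * (A * p.lamA / p.lamB) *
      Real.arctan (Real.sqrt p.gammaTh)))

end GrantFree

end

/-! Everything is conditioned on `N = n`. Once the number of interferers is frozen, the event that
UE `j` is received depends only on the sources of randomness labelled by reception `j`. These groups
of sources are independent of each other and of the cell. The access probability given `N = n` is
therefore a product: one factor Θ for UE `0` and one factor 1 - Θ for each of the `n` others.
Summing over `n` is the law of total probability (`HasLaw.hasSum_access`). Two computations remain.

The law of `N` is a Poisson law mixed over a size-biased gamma law. Its weights are moments of an
exponentially tilted gamma law, that is, quotients of Gamma values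
(`lintegral_poissonMeasure_sizeBiased_gamma`).

For Θ, reception means that an exponential gain exceeds an independent random threshold `T`, so its
probability is the mean of exp(-T) (`HasLaw.measure_receivedOf`). Noise, intra-cell and inter-cell
interference add up in `T`, so this mean factorizes. Noise gives a constant, and each of the `n`
intra-cell gains gives 1/(1 + γ). The inter-cell factor is the Laplace transform of a marked Poisson
sum (`HasLaw.lintegral_expNeg_inter`). Averaging out the marks leaves a product over the points of a
function `G` of position, and the Laplace functional (`IsPoissonProcess.laplace`) turns it into
exp(-λ ∫ (1 - G)) with λ the intensity of the interferers. For a link distance `r`, the plane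
integral is π r² √γ arctan √γ. The mean of π r² is 1/λ_B, because π r² is exponential of rate λ_B by
the void probabilities.

Sums and interferences may be infinite, so the argument is run in `[0, ∞]` with `expNeg`, where no
integrability has to be checked. -/

namespace GrantFree

/-! ### The exponential on `[0, ∞]` and the Poisson generating function -/

/-- The function `t ↦ exp (-t)` on `[0, ∞]`. -/
noncomputable def expNeg (t : ℝ≥0∞) : ℝ≥0∞ := EReal.exp (-(t : EReal))

@[simp] lemma expNeg_zero : expNeg 0 = 1 := by simp [expNeg]

@[simp] lemma expNeg_top : expNeg ∞ = 0 := by simp [expNeg]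

lemma expNeg_ofReal {x : ℝ} (hx : 0 ≤ x) :
    expNeg (ENNReal.ofReal x) = ENNReal.ofReal (Real.exp (-x)) := by
  rw [expNeg, EReal.coe_ennreal_ofReal, max_eq_left hx, ← EReal.coe_neg, EReal.exp_coe]

lemma expNeg_coe (x : ℝ≥0) : expNeg x = ENNReal.ofReal (Real.exp (-x)) := by
  rw [← expNeg_ofReal x.coe_nonneg, ENNReal.ofReal_coe_nnreal]

lemma expNeg_add (s t : ℝ≥0∞) : expNeg (s + t) = expNeg s * expNeg t := by
  induction s with
  | top => simp
  | coe s =>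
    induction t with
    | top => simp
    | coe t =>
      rw [← ENNReal.coe_add, expNeg_coe, expNeg_coe, expNeg_coe,
        ← ENNReal.ofReal_mul (Real.exp_pos _).le, ← Real.exp_add]
      congr 2
      push_cast
      ring

lemma expNeg_sum {ι : Type*} (s : Finset ι) (f : ι → ℝ≥0∞) :
    expNeg (∑ i ∈ s, f i) = ∏ i ∈ s, expNeg (f i) := by
  classical
  induction s using Finset.induction_on with
  | empty => simp
  | insert i s hi ih => rw [Finset.sum_insert hi, Finset.prod_insert hi, expNeg_add, ih]

lemma expNeg_natCast_mul (n : ℕ) (c : ℝ≥0∞) : expNeg (n * c) = expNeg c ^ n := by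
  simpa using expNeg_sum (Finset.range n) (fun _ => c)

lemma continuous_expNeg : Continuous expNeg :=
  ENNReal.continuous_exp.comp (continuous_neg.comp continuous_coe_ennreal_ereal)

@[fun_prop] lemma measurable_expNeg : Measurable expNeg := continuous_expNeg.measurable

lemma expNeg_antitone : Antitone expNeg := fun _ _ h =>
  EReal.exp_monotone (EReal.neg_le_neg_iff.2 (EReal.coe_ennreal_le_coe_ennreal_iff.2 h))

lemma expNeg_le_one (t : ℝ≥0∞) : expNeg t ≤ 1 := by
  simpa using expNeg_antitone (zero_le (a := t))

/-- A right inverse of `expNeg` on `[0, 1]`. -/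
noncomputable def negLog (x : ℝ≥0∞) : ℝ≥0∞ := (-ENNReal.log x).toENNReal

@[fun_prop] lemma measurable_negLog : Measurable negLog := by
  unfold negLog
  have : Measurable fun x => -ENNReal.log x :=
    (continuous_neg.comp ENNReal.continuous_log).measurable
  exact this.ereal_toENNReal

/-- Any product over points of factors in `[0, 1]`, zero included, thereby becomes `expNeg` of a
sum, the form to which the Laplace functional applies. -/
lemma expNeg_negLog {x : ℝ≥0∞} (hx : x ≤ 1) : expNeg (negLog x) = x := by
  have h : 0 ≤ -ENNReal.log x := by
    rw [EReal.le_neg, neg_zero, ← ENNReal.log_one]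
    exact ENNReal.log_monotone hx
  rw [expNeg, negLog, EReal.coe_toENNReal h, neg_neg, ENNReal.exp_log]

/-- Bounded convergence for `expNeg`. -/
lemma tendsto_lintegral_expNeg {Ω : Type*} [MeasurableSpace Ω] {μ : Measure Ω}
    [IsFiniteMeasure μ] {f : ℕ → Ω → ℝ≥0∞} {g : Ω → ℝ≥0∞} (hf : ∀ n, Measurable (f n))
    (h : ∀ ω, Filter.Tendsto (fun n => f n ω) Filter.atTop (nhds (g ω))) :
    Filter.Tendsto (fun n => ∫⁻ ω, expNeg (f n ω) ∂μ) Filter.atTop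
      (nhds (∫⁻ ω, expNeg (g ω) ∂μ)) :=
  tendsto_lintegral_of_dominated_convergence (fun _ => 1)
    (fun n => measurable_expNeg.comp (hf n)) (fun _ => .of_forall fun _ => expNeg_le_one _)
    (by simp) (.of_forall fun ω => (continuous_expNeg.tendsto _).comp (h ω))

/-- The probability generating function of the Poisson law. -/
lemma tsum_poissonMeasure_mul_pow (r : ℝ≥0) {x : ℝ≥0∞} (hx : x ≤ 1) :
    ∑' n, poissonMeasure r {n} * x ^ n = expNeg (r * (1 - x)) := by
  lift x to ℝ≥0 using (hx.trans_lt ENNReal.one_lt_top).ne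
  have hx' : (x : ℝ) ≤ 1 := by exact_mod_cast hx
  have key : HasSum (fun n : ℕ => Real.exp (-r) * r ^ n / n.factorial * (x : ℝ) ^ n)
      (Real.exp (-(r * (1 - x)))) := by
    have h := (NormedSpace.expSeries_div_hasSum_exp ((r * x : ℝ))).mul_left (Real.exp (-r))
    rw [← Real.exp_eq_exp_ℝ, ← Real.exp_add] at h
    convert! h using 1
    · ext n
      rw [mul_pow]
      ring
    · congr 1
      ring
  have h1 : (r : ℝ≥0∞) * (1 - x) = ENNReal.ofReal (r * (1 - x)) := by
    rw [ENNReal.ofReal_mul r.coe_nonneg, ENNReal.ofReal_sub _ x.coe_nonneg]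
    simp
  rw [h1, expNeg_ofReal (mul_nonneg r.coe_nonneg (sub_nonneg.2 hx')), ← key.tsum_eq,
    ENNReal.ofReal_tsum_of_nonneg (fun n => by positivity) key.summable]
  congr 1
  ext n
  rw [poissonMeasure_singleton, ENNReal.ofReal_mul (by positivity),
    ENNReal.ofReal_pow x.coe_nonneg, ENNReal.ofReal_coe_nnreal]

/-! ### The Laplace functional of a Poisson process -/

section Laplace

variable {Ω : Type*} [MeasurableSpace Ω] {μ : Measure Ω}
  {Φ : Ω → Measure Plane} {Λ : Measure Plane}

lemma IsPoissonProcess.measurable_count (h : IsPoissonProcess μ Φ Λ) {B : Set Plane}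
    (hB : MeasurableSet B) : Measurable fun ω => Φ ω B :=
  (Measure.measurable_coe hB).comp h.measurable

variable [IsProbabilityMeasure μ]

/-- Splitting over the value of the count gives the Poisson generating function at `expNeg c`. -/
lemma IsPoissonProcess.lintegral_expNeg_count (h : IsPoissonProcess μ Φ Λ) {B : Set Plane}
    (hB : MeasurableSet B) (hΛ : Λ B ≠ ∞) (c : ℝ≥0∞) :
    ∫⁻ ω, expNeg (c * Φ ω B) ∂μ = expNeg ((1 - expNeg c) * Λ B) := by
  have hm (n : ℕ) : MeasurableSet {ω | Φ ω B = n} :=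
    h.measurable_count hB (measurableSet_singleton _)
  have hd : Pairwise (Function.onFun Disjoint fun n : ℕ => {ω | Φ ω B = n}) := by
    intro i j hij
    refine Set.disjoint_left.2 fun ω (h1 : Φ ω B = i) (h2 : Φ ω B = j) => hij ?_
    exact_mod_cast h1.symm.trans h2
  -- The count is only known to lie in `[0, ∞]`; since the Poisson weights sum to 1, it is almost
  -- surely a natural number.
  have hfull : μ (⋃ n : ℕ, {ω | Φ ω B = n}) = 1 := by
    rw [measure_iUnion hd hm]
    simp_rw [h.count_law B hB hΛ]
    simpa using tsum_poissonMeasure_mul_pow (Λ B).toNNReal (x := 1) le_rfl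
  have hae : ∀ᵐ ω ∂μ, ω ∈ ⋃ n : ℕ, {ω | Φ ω B = n} :=
    (mem_ae_iff_prob_eq_one (.iUnion hm)).2 hfull
  rw [← setLIntegral_univ, ← setLIntegral_congr (s := ⋃ n : ℕ, {ω | Φ ω B = n})
    (Filter.eventuallyEq_univ.2 hae), lintegral_iUnion hm hd]
  have (n : ℕ) : ∫⁻ ω in {ω | Φ ω B = n}, expNeg (c * Φ ω B) ∂μ
      = poissonMeasure (Λ B).toNNReal {n} * expNeg c ^ n := by
    rw [setLIntegral_congr_fun (g := fun _ => expNeg c ^ n) (hm n), setLIntegral_const,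
      h.count_law B hB hΛ, mul_comm]
    intro ω (hω : Φ ω B = n)
    simp only [hω]
    rw [mul_comm, expNeg_natCast_mul]
  simp_rw [this]
  rw [tsum_poissonMeasure_mul_pow _ (expNeg_le_one c), ENNReal.coe_toNNReal hΛ, mul_comm]

lemma IsPoissonProcess.lintegral_expNeg_sum (h : IsPoissonProcess μ Φ Λ) {B : ℕ → Set Plane}
    (hB : ∀ i, MeasurableSet (B i)) (hd : Pairwise fun i j => Disjoint (B i) (B j))
    (hΛ : ∀ i, Λ (B i) ≠ ∞) (c : ℕ → ℝ≥0∞) (s : Finset ℕ) :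
    ∫⁻ ω, expNeg (∑ i ∈ s, c i * Φ ω (B i)) ∂μ
      = expNeg (∑ i ∈ s, (1 - expNeg (c i)) * Λ (B i)) := by
  have hi := (h.count_indep B hB hd).comp (fun i x => expNeg (c i * x)) (fun i => by fun_prop)
  simp_rw [expNeg_sum]
  have := lintegral_prod_eq_prod_lintegral_of_indepFun s _ hi
    (fun i => measurable_expNeg.comp ((h.measurable_count (hB i)).const_mul (c i)))
  simp only [Function.comp_apply] at this
  rw [this]
  exact Finset.prod_congr rfl fun i _ => h.lintegral_expNeg_count (hB i) (hΛ i) (c i)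

lemma IsPoissonProcess.lintegral_expNeg_simpleFunc (h : IsPoissonProcess μ Φ Λ)
    (f : SimpleFunc Plane ℝ≥0∞) (hf : Λ (Function.support f) ≠ ∞) :
    ∫⁻ ω, expNeg (∫⁻ x, f x ∂Φ ω) ∂μ = expNeg (∫⁻ x, (1 - expNeg (f x)) ∂Λ) := by
  classical
  -- The value 0 is discarded because its level set may have infinite intensity. The other level
  -- sets are padded with `∅` and coefficient 0, since independence of counts is stated for
  -- sequences of sets.
  set s : Finset ℝ≥0∞ := f.range.filter (· ≠ 0) with hs
  let B : ℕ → Set Plane := fun i =>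
    if hi : i < s.card then f ⁻¹' {(s.equivFin.symm ⟨i, hi⟩ : ℝ≥0∞)} else ∅
  let c : ℕ → ℝ≥0∞ := fun i => if hi : i < s.card then s.equivFin.symm ⟨i, hi⟩ else 0
  have hB : ∀ i, MeasurableSet (B i) := by
    intro i
    by_cases hi : i < s.card
    · simp only [B, hi, dite_true]
      exact f.measurableSet_preimage _
    · simp [B, hi]
  have hd : Pairwise fun i j => Disjoint (B i) (B j) := by
    intro i j hij
    refine Set.disjoint_left.2 fun x hxi hxj => hij ?_
    by_cases hi : i < s.card
    · by_cases hj : j < s.card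
      · simp only [B, hi, hj, dite_true, Set.mem_preimage, Set.mem_singleton_iff] at hxi hxj
        have := s.equivFin.symm.injective (Subtype.ext (hxi.symm.trans hxj))
        exact congrArg Fin.val this
      · simp [B, hj] at hxj
    · simp [B, hi] at hxi
  have hΛ : ∀ i, Λ (B i) ≠ ∞ := by
    intro i
    by_cases hi : i < s.card
    · refine ne_top_of_le_ne_top hf (measure_mono fun x hx => ?_)
      simp only [B, hi, dite_true, Set.mem_preimage, Set.mem_singleton_iff] at hx
      rw [Function.mem_support, hx]
      exact (Finset.mem_filter.1 (s.equivFin.symm ⟨i, hi⟩).2).2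
    · simp [B, hi]
  -- Serves both sides: `F y = y` against the random measure, `F y = 1 - expNeg y` against the
  -- intensity.
  have key (F : ℝ≥0∞ → ℝ≥0∞) (hF : F 0 = 0) (ν : Measure Plane) :
      ∫⁻ x, F (f x) ∂ν = ∑ i ∈ Finset.range s.card, F (c i) * ν (B i) := by
    have h1 : ∫⁻ x, F (f x) ∂ν = ∑ y ∈ f.range, F y * ν (f ⁻¹' {y}) := by
      rw [← SimpleFunc.map_lintegral, ← SimpleFunc.lintegral_eq_lintegral]
      rfl
    rw [h1, ← Finset.sum_filter_of_ne (p := (· ≠ 0)), ← hs, ← Finset.sum_coe_sort s,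
      ← s.equivFin.symm.sum_comp, Finset.sum_range]
    · refine Finset.sum_congr rfl fun i _ => ?_
      simp [c, B]
    · rintro y - hy rfl
      simp [hF] at hy
  have h2 := h.lintegral_expNeg_sum hB hd hΛ c (Finset.range s.card)
  rw [key (fun y => 1 - expNeg y) (by simp) Λ, ← h2]
  congr 1
  ext ω
  rw [key (fun y => y) rfl]

/-- The Laplace functional of a Poisson process. -/
theorem IsPoissonProcess.laplace [SigmaFinite Λ] (h : IsPoissonProcess μ Φ Λ)
    {v : Plane → ℝ≥0∞} (hv : Measurable v) :
    ∫⁻ ω, expNeg (∫⁻ x, v x ∂Φ ω) ∂μ = expNeg (∫⁻ x, (1 - expNeg (v x)) ∂Λ) := by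
  -- Truncating to the spanning sets keeps the support of finite intensity, and the approximations
  -- still increase to `v`.
  let f : ℕ → SimpleFunc Plane ℝ≥0∞ := fun n =>
    (SimpleFunc.eapprox v n).restrict (spanningSets Λ n)
  have hfn (n : ℕ) : ⇑(f n) = (spanningSets Λ n).indicator (SimpleFunc.eapprox v n) :=
    SimpleFunc.coe_restrict _ (measurableSet_spanningSets Λ n)
  have hmono : Monotone fun n x => f n x := by
    intro m n hmn x
    simp only [hfn]
    exact (Set.indicator_le_indicator_of_subset (monotone_spanningSets Λ hmn)
      (fun _ => zero_le) x).trans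
      (Set.indicator_le_indicator (SimpleFunc.monotone_eapprox v hmn x))
  have hsup (x : Plane) : Filter.Tendsto (fun n => f n x) Filter.atTop (nhds (v x)) := by
    have h1 := tendsto_atTop_iSup 
      (fun m n hmn => SimpleFunc.monotone_eapprox v hmn x : Monotone fun n => SimpleFunc.eapprox v n x)
    rw [SimpleFunc.iSup_eapprox_apply hv] at h1
    refine h1.congr' ?_
    have : x ∈ ⋃ n, spanningSets Λ n := by simp [iUnion_spanningSets]
    obtain ⟨k, hk⟩ := Set.mem_iUnion.1 this
    filter_upwards [Filter.eventually_ge_atTop k] with n hn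
    rw [hfn, Set.indicator_of_mem (monotone_spanningSets Λ hn hk)]
  have hL : Filter.Tendsto (fun n => ∫⁻ ω, expNeg (∫⁻ x, f n x ∂Φ ω) ∂μ) Filter.atTop
      (nhds (∫⁻ ω, expNeg (∫⁻ x, v x ∂Φ ω) ∂μ)) := by
    refine tendsto_lintegral_expNeg (fun n => ?_) fun ω => ?_
    · exact (Measure.measurable_lintegral (f n).measurable).comp h.measurable
    · exact lintegral_tendsto_of_tendsto_of_monotone (fun n => (f n).measurable.aemeasurable)
        (.of_forall fun x m n hmn => hmono hmn x) (.of_forall hsup)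
  have hR : Filter.Tendsto (fun n => expNeg (∫⁻ x, (1 - expNeg (f n x)) ∂Λ)) Filter.atTop
      (nhds (expNeg (∫⁻ x, (1 - expNeg (v x)) ∂Λ))) := by
    refine (continuous_expNeg.tendsto _).comp (lintegral_tendsto_of_tendsto_of_monotone
      (fun n => ?_) (.of_forall fun x m n hmn => tsub_le_tsub_left (expNeg_antitone (hmono hmn x)) _)
      (.of_forall fun x => ?_))
    · exact ((measurable_expNeg.comp (f n).measurable).const_sub 1).aemeasurable
    · exact ENNReal.Tendsto.sub tendsto_const_nhds
        ((continuous_expNeg.tendsto _).comp (hsup x)) (Or.inl ENNReal.one_ne_top)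
  refine tendsto_nhds_unique hL (hR.congr fun n => ?_)
  refine (h.lintegral_expNeg_simpleFunc (f n) (ne_top_of_le_ne_top
    (measure_spanningSets_lt_top Λ n).ne (measure_mono ?_))).symm
  rw [hfn]
  exact Set.support_indicator_subset

end Laplace

/-! ### Gamma and exponential laws -/

section Gamma

lemma measurable_gammaPDF (a r : ℝ) : Measurable (gammaPDF a r) :=
  (measurable_gammaPDFReal a r).ennreal_ofReal

/-- Moments of an exponentially tilted gamma law. -/
lemma lintegral_pow_mul_exp_gammaMeasure {a r s : ℝ} (ha : 0 < a) (hr : 0 < r) (hs : 0 ≤ s)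
    (n : ℕ) :
    ∫⁻ x, ENNReal.ofReal (x ^ n * Real.exp (-(s * x))) ∂gammaMeasure a r =
      ENNReal.ofReal (r ^ a * Real.Gamma (a + n) / (Real.Gamma a * (r + s) ^ (a + n))) := by
  have han : 0 < a + n := by positivity
  have hrs : 0 < r + s := by positivity
  have hG := Real.Gamma_pos_of_pos ha
  have hGn := Real.Gamma_pos_of_pos han
  rw [gammaMeasure, lintegral_withDensity_eq_lintegral_mul _
    (measurable_gammaPDF a r) (by fun_prop)]
  have h0 : ∀ᵐ x : ℝ, x ≠ 0 := by simp [ae_iff]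
  rw [lintegral_congr_ae (g := fun x => ENNReal.ofReal (r ^ a * Real.Gamma (a + n) /
    (Real.Gamma a * (r + s) ^ (a + n))) * gammaPDF (a + n) (r + s) x), lintegral_const_mul _
    (measurable_gammaPDF _ _), lintegral_gammaPDF_eq_one han hrs, mul_one]
  filter_upwards [h0] with x hx
  rcases lt_or_gt_of_ne hx with hx | hx
  · simp [gammaPDF_of_neg hx]
  · rw [Pi.mul_apply, gammaPDF_of_nonneg hx.le, gammaPDF_of_nonneg hx.le,
      ← ENNReal.ofReal_mul (by positivity), ← ENNReal.ofReal_mul (by positivity)]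
    congr 1
    have h1 : x ^ (a + n - 1) = x ^ (a - 1) * x ^ n := by
      rw [← Real.rpow_natCast x n, ← Real.rpow_add hx]
      congr 1
      ring
    have h2 : Real.exp (-((r + s) * x)) = Real.exp (-(r * x)) * Real.exp (-(s * x)) := by
      rw [← Real.exp_add]
      congr 1
      ring
    rw [h1, h2]
    have h3 : (r + s) ^ (a + n) ≠ 0 := (Real.rpow_pos_of_pos hrs _).ne'
    field_simp

lemma ae_nonneg_gammaMeasure (a r : ℝ) : ∀ᵐ x ∂gammaMeasure a r, 0 ≤ x := by
  rw [gammaMeasure, ae_withDensity_iff (measurable_gammaPDF a r)]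
  refine .of_forall fun x hx => ?_
  by_contra h
  exact hx (gammaPDF_of_neg (not_le.1 h))

/-- Poisson counts whose mean is proportional to a size-biased gamma variable. -/
lemma lintegral_poissonMeasure_sizeBiased_gamma {c t : ℝ} (hc : 0 < c) (ht : 0 ≤ t) (n : ℕ) :
    ∫⁻ x, poissonMeasure (Real.toNNReal (t * x)) {n} ∂sizeBiased (gammaMeasure c c) =
      ENNReal.ofReal ((c ^ (c + 1) * Real.Gamma (n + c + 1) * t ^ n) /
        (Real.Gamma (c + 1) * Real.Gamma (n + 1) * (t + c) ^ ((n : ℝ) + c + 1))) := by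
  have hG := Real.Gamma_pos_of_pos hc
  -- Equal shape and rate give mean 1, so the size-biased law needs no normalization.
  have hmean : ∫⁻ x, ENNReal.ofReal x ∂gammaMeasure c c = 1 := by
    have := lintegral_pow_mul_exp_gammaMeasure hc hc le_rfl 1
    simp only [pow_one, zero_mul, neg_zero, Real.exp_zero, mul_one, add_zero, Nat.cast_one] at this
    have hcc := Real.rpow_pos_of_pos hc c
    rw [this, Real.Gamma_add_one hc.ne', Real.rpow_add hc, Real.rpow_one, ENNReal.ofReal_eq_one]
    field_simp
  rw [sizeBiased, hmean, inv_one, one_smul]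
  have hmeas : Measurable fun x : ℝ => poissonMeasure (Real.toNNReal (t * x)) {n} := by
    simp_rw [poissonMeasure_singleton]
    fun_prop
  -- In the exponent `n + 1`, the Poisson weight contributes `n` and the size bias contributes 1.
  rw [lintegral_withDensity_eq_lintegral_mul _ ENNReal.measurable_ofReal hmeas,
    lintegral_congr_ae (g := fun x => ENNReal.ofReal (t ^ n / n.factorial) *
      ENNReal.ofReal (x ^ (n + 1) * Real.exp (-(t * x)))), lintegral_const_mul _ (by fun_prop),
    lintegral_pow_mul_exp_gammaMeasure hc hc ht, ← ENNReal.ofReal_mul (by positivity)]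
  · congr 1
    rw [Real.Gamma_nat_eq_factorial, Real.Gamma_add_one hc.ne', Real.rpow_add hc, Real.rpow_one]
    have e1 : c + ((n + 1 : ℕ) : ℝ) = n + c + 1 := by push_cast; ring
    rw [e1, add_comm t c]
    have h3 : (c + t) ^ ((n : ℝ) + c + 1) ≠ 0 := (Real.rpow_pos_of_pos (by positivity) _).ne'
    field_simp
  · filter_upwards [ae_nonneg_gammaMeasure c c] with x hx
    rw [Pi.mul_apply, poissonMeasure_singleton, Real.coe_toNNReal _ (by positivity),
      ← ENNReal.ofReal_mul hx, ← ENNReal.ofReal_mul (by positivity)]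
    congr 1
    rw [mul_pow]
    ring

instance : IsProbabilityMeasure (expMeasure 1) := isProbabilityMeasure_expMeasure one_pos

lemma ae_pos_expMeasure : ∀ᵐ x ∂expMeasure 1, 0 < x := by
  have h : expMeasure 1 (Set.Iic 0) = 0 := by
    rw [← ofReal_cdf, cdf_expMeasure_eq one_pos]
    simp
  refine measure_mono_null (fun x hx => ?_) h
  simpa using hx

/-- The tail of the standard exponential law. -/
lemma expMeasure_ofReal_ge (T : ℝ≥0∞) : expMeasure 1 {x | T ≤ ENNReal.ofReal x} = expNeg T := by
  induction T with
  | top => simp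
  | coe t =>
    have hac : expMeasure 1 ≪ volume := withDensity_absolutelyContinuous _ _
    -- The law has no atoms, so the closed tail is the complement of the set measured by the cdf.
    have h1 : ∀ᵐ x ∂expMeasure 1, x ≠ (t : ℝ) :=
      hac.ae_le (compl_mem_ae_iff.2 (measure_singleton (t : ℝ)))
    have h2 : expMeasure 1 {x : ℝ | (t : ℝ≥0∞) ≤ ENNReal.ofReal x} =
        expMeasure 1 (Set.Iic (t : ℝ))ᶜ := by
      refine measure_congr (Filter.eventuallyEq_set.2 ?_)
      filter_upwards [h1, ae_pos_expMeasure] with x hx hx0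
      change (t : ℝ≥0∞) ≤ ENNReal.ofReal x ↔ ¬ (x ≤ t)
      rw [← ENNReal.ofReal_coe_nnreal, ENNReal.ofReal_le_ofReal_iff hx0.le, not_le]
      exact ⟨fun h => lt_of_le_of_ne h hx.symm, le_of_lt⟩
    rw [h2, prob_compl_eq_one_sub measurableSet_Iic, ← ofReal_cdf,
      cdf_expMeasure_eq one_pos, if_pos t.coe_nonneg, expNeg_coe, one_mul, ← ENNReal.ofReal_one,
      ← ENNReal.ofReal_sub _ (by simp)]
    congr 1
    ring

/-- The Laplace transform of the standard exponential law. -/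
lemma lintegral_expNeg_expMeasure {s : ℝ} (hs : 0 ≤ s) :
    ∫⁻ x, expNeg (ENNReal.ofReal (s * x)) ∂expMeasure 1 = ENNReal.ofReal (1 + s)⁻¹ := by
  have h := lintegral_pow_mul_exp_gammaMeasure one_pos one_pos hs 0
  simp only [pow_zero, one_mul, Nat.cast_zero, add_zero, Real.Gamma_one,
    Real.rpow_one, one_div] at h
  rw [← h]
  refine lintegral_congr_ae ?_
  filter_upwards [ae_pos_expMeasure] with x hx
  rw [expNeg_ofReal (by positivity)]

end Gamma

/-! ### The radial interference integral for path-loss exponent 4 -/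

section Radial

/-- The primitive comes from substituting u = y², which leaves the integrand γR⁴/(u² + γR⁴) up to a
factor 1/2. -/
lemma hasDerivAt_sqrt_mul_arctan {γ R : ℝ} (hγ : 0 < γ) (hR : 0 < R) (y : ℝ) :
    HasDerivAt (fun y => √γ * R ^ 2 / 2 * Real.arctan (y ^ 2 / (√γ * R ^ 2)))
      (y * (γ * R ^ 4 / (y ^ 4 + γ * R ^ 4))) y := by
  have hs : 0 < √γ := Real.sqrt_pos.2 hγ
  have h := (((hasDerivAt_pow 2 y).div_const (√γ * R ^ 2)).arctan).const_mul (√γ * R ^ 2 / 2)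
  convert! h using 1
  have hγ2 : γ = √γ ^ 2 := (Real.sq_sqrt hγ.le).symm
  have h1 : y ^ 4 + √γ ^ 2 * R ^ 4 ≠ 0 := by positivity
  have h2 : 1 + (y ^ 2 / (√γ * R ^ 2)) ^ 2 ≠ 0 := by positivity
  rw [hγ2, Real.sqrt_sq hs.le]
  field_simp
  push_cast
  ring

/-- The primitive between `R` and infinity involves π/2 - arctan(1/√γ), which equals arctan √γ. -/
lemma integral_Ioi_radial {γ R : ℝ} (hγ : 0 < γ) (hR : 0 < R) :
    IntegrableOn (fun y => y * (γ * R ^ 4 / (y ^ 4 + γ * R ^ 4))) (Set.Ioi R) ∧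
    ∫ y in Set.Ioi R, y * (γ * R ^ 4 / (y ^ 4 + γ * R ^ 4)) =
      √γ * R ^ 2 / 2 * Real.arctan (√γ) := by
  have hs : 0 < √γ := Real.sqrt_pos.2 hγ
  have hd := fun y (_ : y ∈ Set.Ici R) => hasDerivAt_sqrt_mul_arctan hγ hR y
  have hpos : ∀ y ∈ Set.Ioi R, 0 ≤ y * (γ * R ^ 4 / (y ^ 4 + γ * R ^ 4)) := by
    intro y (hy : R < y)
    have := hR.trans hy
    positivity
  have hlim : Filter.Tendsto
      (fun y => √γ * R ^ 2 / 2 * Real.arctan (y ^ 2 / (√γ * R ^ 2))) Filter.atTop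
      (nhds (√γ * R ^ 2 / 2 * (Real.pi / 2))) :=
    ((tendsto_nhds_of_tendsto_nhdsWithin Real.tendsto_arctan_atTop).comp
      ((Filter.tendsto_pow_atTop two_ne_zero).atTop_div_const (by positivity))).const_mul _
  refine ⟨integrableOn_Ioi_deriv_of_nonneg' hd hpos hlim, ?_⟩
  rw [integral_Ioi_of_hasDerivAt_of_nonneg' hd hpos hlim]
  have : R ^ 2 / (√γ * R ^ 2) = (√γ)⁻¹ := by field_simp
  rw [this, Real.arctan_inv_of_pos hs]
  ring

/-- The mean interference integral over the plane outside the disc of radius `R`. -/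
lemma lintegral_plane_radial {γ R : ℝ} (hγ : 0 < γ) (hR : 0 ≤ R) :
    ∫⁻ x : Plane, (if R < ‖x‖ then ENNReal.ofReal (γ * R ^ 4 / (‖x‖ ^ 4 + γ * R ^ 4)) else 0) =
      ENNReal.ofReal (Real.pi * R ^ 2) * ENNReal.ofReal (√γ * Real.arctan (√γ)) := by
  rcases hR.eq_or_lt with rfl | hR
  · simp
  let f : ℝ → ℝ := (Set.Ioi R).indicator fun y => γ * R ^ 4 / (y ^ 4 + γ * R ^ 4)
  have hf (x : Plane) : (if R < ‖x‖ then ENNReal.ofReal (γ * R ^ 4 / (‖x‖ ^ 4 + γ * R ^ 4)) else 0)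
      = ENNReal.ofReal (f ‖x‖) := by
    by_cases h : R < ‖x‖ <;> simp [f, h]
  simp_rw [hf]
  obtain ⟨hint, hval⟩ := integral_Ioi_radial hγ hR
  have hdim : Module.finrank ℝ Plane = 2 := by simp
  have hg : (fun y : ℝ => y ^ (Module.finrank ℝ Plane - 1) • f y) =
      (Set.Ioi R).indicator fun y => y * (γ * R ^ 4 / (y ^ 4 + γ * R ^ 4)) := by
    ext y
    by_cases h : R < y <;> simp [f, h]
  have hI : Integrable (fun x : Plane => f ‖x‖) := by
    rw [integrable_fun_norm_addHaar, hg]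
    exact (integrable_indicator_iff measurableSet_Ioi).2 hint |>.integrableOn
  have hnn (x : Plane) : 0 ≤ f ‖x‖ := Set.indicator_nonneg (fun y _ => by positivity) _
  -- Polar coordinates: the angular constant is the dimension 2 times the area π of the unit disc.
  rw [← ofReal_integral_eq_lintegral_ofReal hI (.of_forall hnn), integral_fun_norm_addHaar, hg,
    setIntegral_indicator measurableSet_Ioi, Set.inter_eq_right.2 (Set.Ioi_subset_Ioi hR.le), hval,
    ← ENNReal.ofReal_mul (by positivity), hdim, measureReal_def,
    EuclideanSpace.volume_ball_fin_two]
  congr 1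
  simp [ENNReal.toReal_ofReal Real.pi_pos.le]
  ring

end Radial

/-! ### Distance to the nearest base station -/

section NearestDist

lemma nearestDist_nonneg (Φ : Measure Plane) : 0 ≤ nearestDist Φ :=
  Real.sInf_nonneg fun _ h => h.1

/-- The distance to the nearest point is at least `r` iff no smaller disc is occupied, unless the
configuration is empty. -/
lemma le_nearestDist_iff {r : ℝ} (hr : 0 < r) (Φ : Measure Plane) :
    r ≤ nearestDist Φ ↔ (∀ q : ℚ, (q : ℝ) < r → Φ (Metric.closedBall 0 q) = 0) ∧
      ∃ n : ℕ, Φ (Metric.closedBall 0 n) ≠ 0 := by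
  have hbdd : BddBelow {r : ℝ | 0 ≤ r ∧ Φ (Metric.closedBall 0 r) ≠ 0} := ⟨0, fun _ h => h.1⟩
  constructor
  · intro h
    refine ⟨fun q hq => ?_, ?_⟩
    · by_contra hne
      rcases lt_or_ge (q : ℝ) 0 with h0 | h0
      · simp [Metric.closedBall_eq_empty.2 h0] at hne
      · exact absurd (h.trans (csInf_le hbdd ⟨h0, hne⟩)) (not_le.2 hq)
    -- An empty configuration has `nearestDist` equal to `sInf ∅ = 0`, which contradicts `0 < r`.
    · by_contra! hne
      have : {r : ℝ | 0 ≤ r ∧ Φ (Metric.closedBall 0 r) ≠ 0} = ∅ := by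
        refine Set.eq_empty_of_forall_notMem fun s hs => hs.2 ?_
        obtain ⟨n, hn⟩ := exists_nat_ge s
        exact measure_mono_null (Metric.closedBall_subset_closedBall hn) (hne n)
      rw [nearestDist, this, Real.sInf_empty] at h
      exact absurd h (not_le.2 hr)
  · rintro ⟨h1, n, hn⟩
    refine le_csInf ⟨n, n.cast_nonneg, hn⟩ fun s hs => ?_
    by_contra! hsr
    obtain ⟨q, hq1, hq2⟩ := exists_rat_btwn hsr
    exact hs.2 (measure_mono_null (Metric.closedBall_subset_closedBall hq1.le) (h1 q hq2))

-- Rational radii suffice to test emptiness of smaller discs, so superlevel sets are built from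
-- countably many void events.
@[fun_prop] lemma measurable_nearestDist : Measurable nearestDist := by
  refine measurable_of_Ici fun r => ?_
  rcases le_or_gt r 0 with hr | hr
  · convert! MeasurableSet.univ
    exact Set.eq_univ_of_forall fun Φ => hr.trans (nearestDist_nonneg Φ)
  · have hm (s : ℝ) : MeasurableSet {Φ : Measure Plane | Φ (Metric.closedBall 0 s) = 0} :=
      Measure.measurable_coe Metric.isClosed_closedBall.measurableSet (measurableSet_singleton 0)
    have : nearestDist ⁻¹' Set.Ici r =
        (⋂ q : ℚ, ⋂ _ : (q : ℝ) < r, {Φ : Measure Plane | Φ (Metric.closedBall 0 q) = 0}) ∩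
          ⋃ n : ℕ, {Φ : Measure Plane | Φ (Metric.closedBall 0 n) = 0}ᶜ := by
      ext Φ
      simpa using le_nearestDist_iff hr Φ
    rw [this]
    exact .inter (.iInter fun q => .iInter fun _ => hm q) (.iUnion fun n => (hm n).compl)

variable {Ω : Type*} [MeasurableSpace Ω] {μ : Measure Ω}
  {Φ : Ω → Measure Plane} {Λ : Measure Plane}

/-- The void probabilities of a Poisson process. -/
lemma IsPoissonProcess.measure_count_eq_zero (h : IsPoissonProcess μ Φ Λ) {B : Set Plane}
    (hB : MeasurableSet B) (hΛ : Λ B ≠ ∞) : μ {ω | Φ ω B = 0} = expNeg (Λ B) := by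
  have := h.count_law B hB hΛ 0
  rw [Nat.cast_zero] at this
  rw [this, poissonMeasure_singleton, ← ENNReal.coe_toNNReal hΛ, expNeg_coe]
  simp

variable {l : ℝ}

lemma IsPoissonProcess.measure_closedBall_eq_zero
    (h : IsPoissonProcess μ Φ (ENNReal.ofReal l • volume)) (hl : 0 < l) {r : ℝ} (hr : 0 ≤ r) :
    μ {ω | Φ ω (Metric.closedBall 0 r) = 0} = ENNReal.ofReal (Real.exp (-(l * Real.pi * r ^ 2))) := by
  have hv : (ENNReal.ofReal l • (volume : Measure Plane)) (Metric.closedBall 0 r)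
      = ENNReal.ofReal (l * Real.pi * r ^ 2) := by
    rw [Measure.smul_apply, EuclideanSpace.volume_closedBall_fin_two, smul_eq_mul,
      ← ENNReal.ofReal_pow hr, ← ENNReal.ofReal_mul (by positivity), ← ENNReal.ofReal_mul hl.le]
    congr 1
    ring
  rw [h.measure_count_eq_zero Metric.isClosed_closedBall.measurableSet (by simp [hv]), hv,
    expNeg_ofReal (by have := Real.pi_pos; positivity)]

/-- The law of the distance to the nearest point of a homogeneous Poisson process. -/
lemma IsPoissonProcess.measure_le_nearestDist [IsProbabilityMeasure μ]
    (h : IsPoissonProcess μ Φ (ENNReal.ofReal l • volume)) (hl : 0 < l) {r : ℝ} (hr : 0 < r) :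
    μ {ω | r ≤ nearestDist (Φ ω)} = ENNReal.ofReal (Real.exp (-(l * Real.pi * r ^ 2))) := by
  have hpi := Real.pi_pos
  have hlim (F : ℝ → ℝ) (hF : Continuous F) : Continuous fun s => ENNReal.ofReal (Real.exp (F s)) :=
    ENNReal.continuous_ofReal.comp (Real.continuous_exp.comp hF)
  -- The empty configuration, where the distance takes its default value 0, is negligible: the void
  -- probabilities of growing discs tend to 0.
  have hnull : μ {ω | ∀ n : ℕ, Φ ω (Metric.closedBall 0 n) = 0} = 0 := by
    have hle (n : ℕ) : μ {ω | ∀ n : ℕ, Φ ω (Metric.closedBall 0 n) = 0} ≤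
        ENNReal.ofReal (Real.exp (-(l * Real.pi * (n : ℝ) ^ 2))) := by
      rw [← h.measure_closedBall_eq_zero hl n.cast_nonneg]
      exact measure_mono fun ω hω => hω n
    have ht : Filter.Tendsto (fun n : ℕ => ENNReal.ofReal
        (Real.exp (-(l * Real.pi * (n : ℝ) ^ 2)))) Filter.atTop (nhds 0) := by
      rw [← ENNReal.ofReal_zero]
      refine (ENNReal.continuous_ofReal.tendsto 0).comp (Real.tendsto_exp_neg_atTop_nhds_zero.comp ?_)
      exact Filter.Tendsto.const_mul_atTop (by positivity)
        ((Filter.tendsto_pow_atTop two_ne_zero).comp tendsto_natCast_atTop_atTop)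
    exact le_antisymm (ge_of_tendsto' ht hle) zero_le
  apply le_antisymm
  -- A distance of at least `r` leaves every disc of radius `s < r` empty; then `s` increases to
  -- `r`.
  · have ht : Filter.Tendsto (fun s : ℝ => ENNReal.ofReal (Real.exp (-(l * Real.pi * s ^ 2))))
        (nhdsWithin r (Set.Iio r)) (nhds (ENNReal.ofReal (Real.exp (-(l * Real.pi * r ^ 2))))) :=
      ((hlim _ (by fun_prop)).tendsto r).mono_left nhdsWithin_le_nhds
    refine ge_of_tendsto ht ?_
    filter_upwards [Ioo_mem_nhdsLT hr] with s hs
    rw [← h.measure_closedBall_eq_zero hl hs.1.le]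
    refine measure_mono fun ω hω => ?_
    obtain ⟨q, hq1, hq2⟩ := exists_rat_btwn hs.2
    exact measure_mono_null (Metric.closedBall_subset_closedBall hq1.le)
      (((le_nearestDist_iff hr _).1 hω).1 q hq2)
  · rw [← h.measure_closedBall_eq_zero hl hr.le]
    calc μ {ω | Φ ω (Metric.closedBall 0 r) = 0}
        ≤ μ ({ω | r ≤ nearestDist (Φ ω)} ∪ {ω | ∀ n : ℕ, Φ ω (Metric.closedBall 0 n) = 0}) := by
          refine measure_mono fun ω (hω : Φ ω _ = 0) => ?_
          by_cases hn : ∀ n : ℕ, Φ ω (Metric.closedBall 0 n) = 0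
          · exact Or.inr hn
          · refine Or.inl ((le_nearestDist_iff hr _).2 ⟨fun q hq => ?_, by simpa using hn⟩)
            exact measure_mono_null (Metric.closedBall_subset_closedBall hq.le) hω
      _ ≤ _ := (measure_union_le _ _).trans (by rw [hnull, add_zero])

/-- The mean area of the disc that reaches the nearest point of a homogeneous Poisson process. -/
lemma IsPoissonProcess.lintegral_pi_nearestDist_sq [IsProbabilityMeasure μ]
    (h : IsPoissonProcess μ Φ (ENNReal.ofReal l • volume)) (hl : 0 < l) :
    ∫⁻ ω, ENNReal.ofReal (Real.pi * nearestDist (Φ ω) ^ 2) ∂μ = ENNReal.ofReal l⁻¹ := by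
  have hpi := Real.pi_pos
  have hm : Measurable fun ω => nearestDist (Φ ω) := measurable_nearestDist.comp h.measurable
  rw [lintegral_eq_lintegral_meas_le _ (.of_forall fun ω => by positivity)
    ((hm.pow_const 2).const_mul Real.pi).aemeasurable]
  -- In the layer-cake formula the tail of π r² is exp(-l t), which is 1/l times the density of the
  -- exponential law of rate `l`.
  have h1 : ∀ t ∈ Set.Ioi (0 : ℝ), μ {ω | t ≤ Real.pi * nearestDist (Φ ω) ^ 2} =
      ENNReal.ofReal l⁻¹ * exponentialPDF l t := by
    intro t (ht : 0 < t)
    have hset : {ω | t ≤ Real.pi * nearestDist (Φ ω) ^ 2} =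
        {ω | √(t / Real.pi) ≤ nearestDist (Φ ω)} := by
      ext ω
      rw [Set.mem_ofPred_eq, Set.mem_ofPred_eq, Real.sqrt_le_left (nearestDist_nonneg _), div_le_iff₀' hpi]
    rw [hset, h.measure_le_nearestDist hl (Real.sqrt_pos.2 (by positivity)),
      Real.sq_sqrt (by positivity), exponentialPDF_of_nonneg ht.le,
      ← ENNReal.ofReal_mul (by positivity)]
    congr 1
    field_simp
  have hmeas : Measurable (exponentialPDF l) := (measurable_exponentialPDFReal l).ennreal_ofReal
  rw [setLIntegral_congr_fun measurableSet_Ioi h1, lintegral_const_mul _ hmeas,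
    ← setLIntegral_congr Ioi_ae_eq_Ici.symm]
  have h2 := lintegral_add_compl (μ := volume) (exponentialPDF l) (measurableSet_Ici (a := (0 : ℝ)))
  rw [Set.compl_Ici, lintegral_exponentialPDF_of_nonpos le_rfl, add_zero,
    lintegral_exponentialPDF_eq_one hl] at h2
  rw [h2, mul_one]

end NearestDist

/-! ### Independence of receptions and averaging of marks -/

/-- The reception a source of randomness belongs to, if any. -/
def Source.reception : Source → Option ℕ
  | .cell => none
  | .gain j _ => some j
  | .field j => some j
  | .bs j _ => some j
  | .interGain j _ => some j

namespace Round

variable {Ω : Type*}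

/-- The σ-algebra generated by a set of sources of randomness. -/
@[reducible] def sigmaOf (R : Round Ω) (S : Set Source) : MeasurableSpace Ω := ⨆ s ∈ S, R.sigma s

/-- The event that UE `j` is received when there are `n` interfering UEs in the cell. -/
def receivedOf (R : Round Ω) (p : Params) (g : ℝ) (j n : ℕ) : Set Ω :=
  {ω | ENNReal.ofReal p.gammaTh ≤ ENNReal.ofReal (g * p.rho * R.gain j j ω) /
    (∑ k ∈ (Finset.range (n + 1)).erase j, ENNReal.ofReal (g * p.rho * R.gain j k ω) +
      R.inter p g j ω + ENNReal.ofReal p.sigmaSq)}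

lemma mem_received_iff {R : Round Ω} {p : Params} {g : ℝ} {j : ℕ} {ω : Ω} :
    ω ∈ R.received p g j ↔ ω ∈ R.receivedOf p g j (R.N ω) := Iff.rfl

section Measurability

variable {R : Round Ω} [MeasurableSpace Ω] {j : ℕ}

lemma measurable_linkDist {i : ℕ} (h : Measurable (R.bs j i)) : Measurable (R.linkDist j i) :=
  measurable_nearestDist.comp h

lemma measurable_inter (p : Params) (g : ℝ) (hK : Measurable (R.K j))
    (hloc : ∀ i, Measurable (R.loc j i)) (hbs : ∀ i, Measurable (R.bs j i))
    (hq : ∀ i, Measurable (R.interGain j i)) : Measurable (R.inter p g j) := by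
  refine Measurable.tsum fun i => Measurable.ite ?_ ?_ measurable_const
  · exact (hK (DiscreteMeasurableSpace.forall_measurableSet {k | (i : ℕ∞) < k})).inter
      (measurableSet_lt (measurable_linkDist (hbs i)) (hloc i).norm)
  · have := measurable_linkDist (hbs i)
    have := hq i
    have := hloc i
    unfold transmitPower
    fun_prop

lemma measurableSet_receivedOf (p : Params) (g : ℝ) (n : ℕ) (hg : ∀ k, Measurable (R.gain j k))
    (hK : Measurable (R.K j)) (hloc : ∀ i, Measurable (R.loc j i))
    (hbs : ∀ i, Measurable (R.bs j i)) (hq : ∀ i, Measurable (R.interGain j i)) :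
    MeasurableSet (R.receivedOf p g j n) := by
  have := measurable_inter p g hK hloc hbs hq
  exact measurableSet_le measurable_const (by fun_prop)

end Measurability

variable {R : Round Ω} {S T : Set Source} {j i k : ℕ}

lemma sigma_le_sigmaOf {s : Source} (h : s ∈ S) : R.sigma s ≤ R.sigmaOf S :=
  le_iSup₂_of_le s h le_rfl

lemma sigmaOf_mono (h : S ⊆ T) : R.sigmaOf S ≤ R.sigmaOf T :=
  biSup_mono h

lemma measurable_N_sigmaOf (h : Source.cell ∈ S) : Measurable[R.sigmaOf S] R.N :=
  Measurable.of_comap_le (le_sup_right.trans (sigma_le_sigmaOf h))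

lemma measurable_gain_sigmaOf (h : Source.gain j k ∈ S) : Measurable[R.sigmaOf S] (R.gain j k) :=
  Measurable.of_comap_le (sigma_le_sigmaOf h)

lemma measurable_K_sigmaOf (h : Source.field j ∈ S) : Measurable[R.sigmaOf S] (R.K j) :=
  Measurable.of_comap_le (le_sup_left.trans (sigma_le_sigmaOf h))

lemma measurable_loc_sigmaOf (h : Source.field j ∈ S) (i : ℕ) :
    Measurable[R.sigmaOf S] (R.loc j i) :=
  Measurable.of_comap_le (((le_iSup (fun i => MeasurableSpace.comap (R.loc j i) inferInstance) i).trans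
    le_sup_right).trans (sigma_le_sigmaOf h))

lemma measurable_bs_sigmaOf (h : Source.bs j i ∈ S) : Measurable[R.sigmaOf S] (R.bs j i) :=
  Measurable.of_comap_le (sigma_le_sigmaOf h)

lemma measurable_interGain_sigmaOf (h : Source.interGain j i ∈ S) :
    Measurable[R.sigmaOf S] (R.interGain j i) :=
  Measurable.of_comap_le (sigma_le_sigmaOf h)

lemma measurable_inter_sigmaOf (p : Params) (g : ℝ) (hf : Source.field j ∈ S)
    (hb : ∀ i, Source.bs j i ∈ S) (hq : ∀ i, Source.interGain j i ∈ S) :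
    Measurable[R.sigmaOf S] (R.inter p g j) :=
  @measurable_inter Ω R (R.sigmaOf S) j p g (measurable_K_sigmaOf hf) (measurable_loc_sigmaOf hf)
    (fun i => measurable_bs_sigmaOf (hb i)) (fun i => measurable_interGain_sigmaOf (hq i))

lemma measurableSet_receivedOf_sigmaOf (p : Params) (g : ℝ) (j n : ℕ) :
    MeasurableSet[R.sigmaOf {s | s.reception = some j}] (R.receivedOf p g j n) :=
  @measurableSet_receivedOf Ω R (R.sigmaOf _) j p g n (fun _ => measurable_gain_sigmaOf rfl)
    (measurable_K_sigmaOf rfl) (measurable_loc_sigmaOf rfl) (fun _ => measurable_bs_sigmaOf rfl)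
    (fun _ => measurable_interGain_sigmaOf rfl)

namespace HasLaw

variable [MeasurableSpace Ω] {μ : Measure Ω} {p : Params} {a : ℝ}

lemma sigma_le (h : R.HasLaw p a μ) (s : Source) : R.sigma s ≤ ‹MeasurableSpace Ω› := by
  cases s with
  | cell => exact sup_le h.measurable_area.comap_le h.measurable_N.comap_le
  | gain j k => exact (h.measurable_gain j k).comap_le
  | field j =>
    exact sup_le (h.measurable_K j).comap_le (iSup_le fun i => (h.measurable_loc j i).comap_le)
  | bs j i => exact (h.measurable_bs j i).comap_le
  | interGain j i => exact (h.measurable_interGain j i).comap_le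

lemma sigmaOf_le (h : R.HasLaw p a μ) (S : Set Source) :
    R.sigmaOf S ≤ ‹MeasurableSpace Ω› :=
  iSup₂_le fun s _ => h.sigma_le s

lemma indep_sigmaOf (h : R.HasLaw p a μ) (hST : Disjoint S T) :
    Indep (R.sigmaOf S) (R.sigmaOf T) μ :=
  indep_iSup_of_disjoint h.sigma_le h.indep hST

lemma measurableSet_receivedOf (h : R.HasLaw p a μ) (g : ℝ) (j n : ℕ) :
    MeasurableSet (R.receivedOf p g j n) :=
  h.sigmaOf_le _ _ (measurableSet_receivedOf_sigmaOf p g j n)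

variable {α β : Type*} [MeasurableSpace α] [MeasurableSpace β]

/-- Fubini: disjoint sets of sources are independent, so the joint law is a product and one variable
can be averaged with the other frozen. -/
lemma lintegral_of_disjoint [IsProbabilityMeasure μ] (h : R.HasLaw p a μ) (hST : Disjoint S T)
    {X : Ω → α} {Y : Ω → β} (hX : Measurable[R.sigmaOf S] X) (hY : Measurable[R.sigmaOf T] Y)
    {F : α → β → ℝ≥0∞} (hF : Measurable (Function.uncurry F)) :
    ∫⁻ ω, F (X ω) (Y ω) ∂μ = ∫⁻ ω, ∫⁻ ω', F (X ω) (Y ω') ∂μ ∂μ := by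
  have hX' : Measurable X := hX.mono (h.sigmaOf_le S) le_rfl
  have hY' : Measurable Y := hY.mono (h.sigmaOf_le T) le_rfl
  have hind : IndepFun X Y μ :=
    indep_of_indep_of_le_left (indep_of_indep_of_le_right (h.indep_sigmaOf hST) hY.comap_le)
      hX.comap_le
  have hmap := (indepFun_iff_map_prod_eq_prod_map_map hX'.aemeasurable hY'.aemeasurable).1 hind
  have : IsProbabilityMeasure (μ.map Y) := Measure.isProbabilityMeasure_map hY'.aemeasurable
  calc ∫⁻ ω, F (X ω) (Y ω) ∂μ = ∫⁻ z, Function.uncurry F z ∂μ.map (fun ω => (X ω, Y ω)) := by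
        rw [lintegral_map hF (hX'.prodMk hY')]
        rfl
    _ = ∫⁻ x, ∫⁻ y, F x y ∂μ.map Y ∂μ.map X := by
        rw [hmap, lintegral_prod _ hF.aemeasurable]
        rfl
    _ = _ := by
        have hm : Measurable fun x => ∫⁻ y, F x y ∂μ.map Y := hF.lintegral_prod_right'
        rw [lintegral_map hm hX']
        refine lintegral_congr fun ω => ?_
        exact lintegral_map (f := F (X ω)) (hF.comp measurable_prodMk_left) hY'

/-- Independent marks can be averaged out of a finite product, one by one. -/
lemma lintegral_prod_marks [IsProbabilityMeasure μ] (h : R.HasLaw p a μ)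
    {U : ℕ → Set Source} (hSU : ∀ i, Disjoint S (U i)) (hU : Pairwise fun i j => Disjoint (U i) (U j))
    {X : Ω → α} {M : ℕ → Ω → β} (hX : Measurable[R.sigmaOf S] X)
    (hM : ∀ i, Measurable[R.sigmaOf (U i)] (M i)) {φ : ℕ → α → β → ℝ≥0∞}
    (hφ : ∀ i, Measurable (Function.uncurry (φ i))) (n : ℕ) {H : α → ℝ≥0∞} (hH : Measurable H) :
    ∫⁻ ω, H (X ω) * ∏ i ∈ Finset.range n, φ i (X ω) (M i ω) ∂μ =
      ∫⁻ ω, H (X ω) * ∏ i ∈ Finset.range n, ∫⁻ ω', φ i (X ω) (M i ω') ∂μ ∂μ := by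
  induction n generalizing H with
  | zero => simp
  | succ n ih =>
    have hM' (i : ℕ) : Measurable (M i) := (hM i).mono (h.sigmaOf_le _) le_rfl
    have hdisj : Disjoint (S ∪ ⋃ i ∈ Finset.range n, U i) (U n) := by
      rw [Set.disjoint_union_left, Set.disjoint_iUnion₂_left]
      exact ⟨hSU n, fun i hi => hU (Finset.mem_range.1 hi).ne⟩
    have hY : Measurable[R.sigmaOf (S ∪ ⋃ i ∈ Finset.range n, U i)]
        fun ω => (X ω, fun i : Fin n => M i ω) := by
      refine Measurable.prodMk (hX.mono (sigmaOf_mono Set.subset_union_left) le_rfl) ?_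
      refine (@measurable_pi_iff _ _ _ (R.sigmaOf _) _ _).2 fun i => (hM i).mono (sigmaOf_mono ?_) le_rfl
      exact (Set.subset_biUnion_of_mem (u := U) (Finset.mem_coe.2 (Finset.mem_range.2 i.2))).trans
        Set.subset_union_right
    have hF : Measurable (Function.uncurry fun (z : α × (Fin n → β)) (b : β) =>
        (H z.1 * ∏ i : Fin n, φ i z.1 (z.2 i)) * φ n z.1 b) := by
      refine Measurable.mul (Measurable.mul (hH.comp (by fun_prop)) ?_) ?_
      · exact Finset.measurable_fun_prod _ fun i _ =>
          (hφ i).comp (g := Function.uncurry (φ i))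
            (f := fun z : (α × (Fin n → β)) × β => (z.1.1, z.1.2 i)) (by fun_prop)
      · exact (hφ n).comp (g := Function.uncurry (φ n))
          (f := fun z : (α × (Fin n → β)) × β => (z.1.1, z.2)) (by fun_prop)
    have hstep := h.lintegral_of_disjoint hdisj hY (hM n) hF
    have hprod (ω : Ω) : ∏ i : Fin n, φ i (X ω) (M i ω) =
        ∏ i ∈ Finset.range n, φ i (X ω) (M i ω) := (Finset.prod_range fun i => φ i (X ω) (M i ω)).symm
    simp only [hprod] at hstep
    have hG : Measurable fun x => ∫⁻ ω', φ n x (M n ω') ∂μ := by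
      refine Measurable.lintegral_prod_right' (f := fun z : α × Ω => φ n z.1 (M n z.2)) ?_
      exact (hφ n).comp (measurable_fst.prodMk ((hM' n).comp measurable_snd))
    simp_rw [Finset.prod_range_succ, ← mul_assoc]
    rw [hstep]
    have h1 (ω : Ω) : ∫⁻ ω', (H (X ω) * ∏ i ∈ Finset.range n, φ i (X ω) (M i ω)) *
        φ n (X ω) (M n ω') ∂μ = (H (X ω) * ∫⁻ ω', φ n (X ω) (M n ω') ∂μ) * ∏ i ∈ Finset.range n, φ i (X ω) (M i ω) := by
      rw [lintegral_const_mul]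
      · ring
      · exact (hφ n).comp (measurable_const.prodMk (hM' n))
    simp_rw [h1]
    -- The averaged last factor depends on `X` alone and is absorbed into `H`, which is why the
    -- induction generalizes `H`.
    rw [ih (H := fun x => H x * ∫⁻ ω', φ n x (M n ω') ∂μ) (hH.mul hG)]
    refine lintegral_congr fun ω => ?_
    ring

/-- Events that belong to different receptions are independent. -/
lemma measure_inter_biInter (h : R.HasLaw p a μ) [IsProbabilityMeasure μ] {A : Set Ω}
    (hA : MeasurableSet[R.sigmaOf S] A) {B : ℕ → Set Ω}
    (hB : ∀ j, MeasurableSet[R.sigmaOf {s | s.reception = some j}] (B j)) (t : Finset ℕ)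
    (hS : ∀ j ∈ t, Disjoint S {s | s.reception = some j}) :
    μ (A ∩ ⋂ j ∈ t, B j) = μ A * ∏ j ∈ t, μ (B j) := by
  induction t using Finset.induction_on with
  | empty => simp
  | insert j t hj ih =>
    have hdisj : Disjoint (S ∪ ⋃ i ∈ t, {s : Source | s.reception = some i})
        {s | s.reception = some j} := by
      rw [Set.disjoint_union_left, Set.disjoint_iUnion₂_left]
      refine ⟨hS j (Finset.mem_insert_self j t), fun i hi => Set.disjoint_left.2 ?_⟩
      rintro s (h1 : _ = _) (h2 : _ = _)
      have : i = j := Option.some.inj (h1.symm.trans h2)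
      exact hj (this ▸ hi)
    have hmeas : MeasurableSet[R.sigmaOf (S ∪ ⋃ i ∈ t, {s : Source | s.reception = some i})]
        (A ∩ ⋂ i ∈ t, B i) := by
      refine MeasurableSet.inter (sigmaOf_mono Set.subset_union_left _ hA)
        (Finset.measurableSet_biInter _ fun i hi => sigmaOf_mono ?_ _ (hB i))
      exact (Set.subset_biUnion_of_mem (u := fun i => {s : Source | s.reception = some i})
        (Finset.mem_coe.2 hi)).trans Set.subset_union_right
    have hind := (Indep_iff _ _ μ).1 (h.indep_sigmaOf hdisj) _ _ hmeas (hB j)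
    rw [Finset.prod_insert hj, Finset.set_biInter_insert, Set.inter_comm (B j), ← Set.inter_assoc,
      hind, ih fun i hi => hS i (Finset.mem_insert_of_mem hi)]
    ring

end HasLaw

end Round

/-! ### The Laplace transform of the inter-cell interference -/

lemma lintegral_countingMeasure (K : ℕ∞) (x : ℕ → Plane) {v : Plane → ℝ≥0∞} (hv : Measurable v) :
    ∫⁻ y, v y ∂countingMeasure K x = ∑' i : ℕ, if (i : ℕ∞) < K then v (x i) else 0 := by
  rw [countingMeasure, lintegral_sum_measure]
  refine tsum_congr fun i => ?_
  split_ifs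
  · exact lintegral_dirac' _ hv
  · simp

/-- Laplace transform of the contribution, normalized by `g ρ / γ`, of an interferer at distance
`d` whose BS is at distance `r`, given both distances. -/
noncomputable def interLaplace (γ d r : ℝ) : ℝ≥0∞ :=
  if r < d then ENNReal.ofReal (1 + γ * r ^ 4 / d ^ 4)⁻¹ else 1

lemma measurable_interLaplace (γ : ℝ) :
    Measurable fun z : ℝ × ℝ => interLaplace γ z.1 z.2 :=
  Measurable.ite (measurableSet_lt measurable_snd measurable_fst) (by fun_prop) measurable_const

lemma interLaplace_le_one {γ : ℝ} (hγ : 0 < γ) (d r : ℝ) : interLaplace γ d r ≤ 1 := by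
  unfold interLaplace
  split_ifs
  · rw [ENNReal.ofReal_le_one]
    exact inv_le_one_of_one_le₀ (le_add_of_nonneg_right (by positivity))
  · exact le_rfl

/-- Since 1 - 1/(1 + γr⁴/d⁴) = γr⁴/(d⁴ + γr⁴), this is the radial integral computed above. -/
lemma lintegral_one_sub_interLaplace {γ r : ℝ} (hγ : 0 < γ) (hr : 0 ≤ r) :
    ∫⁻ x : Plane, (1 - interLaplace γ ‖x‖ r) =
      ENNReal.ofReal (Real.pi * r ^ 2) * ENNReal.ofReal (√γ * Real.arctan (√γ)) := by
  rw [← lintegral_plane_radial hγ hr]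
  refine lintegral_congr fun x => ?_
  unfold interLaplace
  split_ifs with h
  · have hx : 0 < ‖x‖ := hr.trans_lt h
    rw [← ENNReal.ofReal_one, ← ENNReal.ofReal_sub _ (by positivity)]
    congr 1
    field_simp
    ring
  · simp

namespace Round

namespace HasLaw

variable {Ω : Type*} [MeasurableSpace Ω] {μ : Measure Ω} [IsProbabilityMeasure μ]
  {R : Round Ω} {p : Params} {a : ℝ}

/-- All BS processes of a reception have the same void probabilities, so the interferer `0` can
represent the marks of all interferers. -/
lemma map_linkDist (h : R.HasLaw p a μ) (j i k : ℕ) :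
    μ.map (R.linkDist j i) = μ.map (R.linkDist j k) := by
  have hm (i : ℕ) : Measurable (R.linkDist j i) := measurable_linkDist (h.measurable_bs j i)
  have := fun i => Measure.isProbabilityMeasure_map (hm i).aemeasurable (μ := μ)
  refine Measure.ext_of_Ici _ _ fun r => ?_
  rw [Measure.map_apply (hm i) measurableSet_Ici, Measure.map_apply (hm k) measurableSet_Ici]
  rcases le_or_gt r 0 with hr | hr
  · have (i : ℕ) : R.linkDist j i ⁻¹' Set.Ici r = Set.univ :=
      Set.eq_univ_of_forall fun ω => hr.trans (nearestDist_nonneg _)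
    rw [this, this]
  · have (i : ℕ) : μ (R.linkDist j i ⁻¹' Set.Ici r) = _ :=
      (h.bs_law j i).measure_le_nearestDist p.lamB_pos hr
    rw [this, this]

/-- The mean of a function of the normalized contribution of the interferer `i` at distance `d`. -/
lemma lintegral_mark (h : R.HasLaw p a μ) {γ : ℝ} (hγ : 0 < γ) (j i : ℕ) (d : ℝ) :
    ∫⁻ ω, expNeg (if R.linkDist j i ω < d then
        ENNReal.ofReal (γ * R.linkDist j i ω ^ 4 / d ^ 4 * R.interGain j i ω) else 0) ∂μ =
      ∫⁻ ω, interLaplace γ d (R.linkDist j 0 ω) ∂μ := by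
  have hbs : Measurable[R.sigmaOf {Source.bs j i}] (R.linkDist j i) :=
    measurable_nearestDist.comp (measurable_bs_sigmaOf (Set.mem_singleton _))
  have hq : Measurable[R.sigmaOf {Source.interGain j i}] (R.interGain j i) :=
    measurable_interGain_sigmaOf (Set.mem_singleton _)
  have hF : Measurable (Function.uncurry fun r q : ℝ => expNeg (if r < d then
      ENNReal.ofReal (γ * r ^ 4 / d ^ 4 * q) else 0)) :=
    measurable_expNeg.comp (Measurable.ite (measurableSet_lt measurable_fst measurable_const)
      (by fun_prop) measurable_const)
  rw [h.lintegral_of_disjoint (by simp) hbs hq hF]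
  have h1 (ω : Ω) : ∫⁻ ω', expNeg (if R.linkDist j i ω < d then
      ENNReal.ofReal (γ * R.linkDist j i ω ^ 4 / d ^ 4 * R.interGain j i ω') else 0) ∂μ =
      interLaplace γ d (R.linkDist j i ω) := by
    unfold interLaplace
    split_ifs with hr
    · rw [← lintegral_expNeg_expMeasure (by positivity), ← h.interGain_law j i,
        lintegral_map (by fun_prop) (h.measurable_interGain j i)]
    · simp
  simp_rw [h1]
  have hm : Measurable (interLaplace γ d) := (measurable_interLaplace γ).comp measurable_prodMk_left
  rw [← lintegral_map hm (measurable_linkDist (h.measurable_bs j i)), h.map_linkDist j i 0,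
    lintegral_map hm (measurable_linkDist (h.measurable_bs j 0))]

/-- Integral over the plane of the mean interference functional. -/
lemma lintegral_plane_one_sub (h : R.HasLaw p a μ) {γ : ℝ} (hγ : 0 < γ) (j : ℕ) :
    ∫⁻ x : Plane, (1 - ∫⁻ ω, interLaplace γ ‖x‖ (R.linkDist j 0 ω) ∂μ) =
      ENNReal.ofReal p.lamB⁻¹ * ENNReal.ofReal (√γ * Real.arctan (√γ)) := by
  have hR := measurable_linkDist (h.measurable_bs j 0)
  have hm : Measurable fun z : Plane × Ω => interLaplace γ ‖z.1‖ (R.linkDist j 0 z.2) :=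
    (measurable_interLaplace γ).comp (g := fun z : ℝ × ℝ => interLaplace γ z.1 z.2)
      (f := fun z : Plane × Ω => (‖z.1‖, R.linkDist j 0 z.2)) (by fun_prop)
  have h1 (x : Plane) : 1 - ∫⁻ ω, interLaplace γ ‖x‖ (R.linkDist j 0 ω) ∂μ =
      ∫⁻ ω, (1 - interLaplace γ ‖x‖ (R.linkDist j 0 ω)) ∂μ := by
    have hmx : Measurable fun ω => interLaplace γ ‖x‖ (R.linkDist j 0 ω) :=
      (measurable_interLaplace γ).comp (measurable_const.prodMk hR)
    have hle : ∫⁻ ω, interLaplace γ ‖x‖ (R.linkDist j 0 ω) ∂μ ≤ 1 :=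
      (lintegral_mono fun ω => interLaplace_le_one hγ _ _).trans (by simp)
    have hsub := lintegral_sub (f := fun _ => (1 : ℝ≥0∞)) hmx
      (ne_top_of_le_ne_top ENNReal.one_ne_top hle)
      (.of_forall fun ω => interLaplace_le_one hγ ‖x‖ (R.linkDist j 0 ω))
    rw [lintegral_one, measure_univ] at hsub
    exact hsub.symm
  simp_rw [h1]
  -- Integrating over the plane first makes the integrand a multiple of π r², so only the mean of π
  -- r² is needed.
  rw [lintegral_lintegral_swap (hm.const_sub 1).aemeasurable]
  have h2 (ω : Ω) : ∫⁻ x : Plane, (1 - interLaplace γ ‖x‖ (R.linkDist j 0 ω)) =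
      ENNReal.ofReal (Real.pi * R.linkDist j 0 ω ^ 2) *
        ENNReal.ofReal (√γ * Real.arctan (√γ)) :=
    lintegral_one_sub_interLaplace hγ (nearestDist_nonneg _)
  simp_rw [h2]
  rw [lintegral_mul_const _ (by fun_prop)]
  congr 1
  exact (h.bs_law j 0).lintegral_pi_nearestDist_sq p.lamB_pos

/-- The Laplace transform of the inter-cell interference at `γ / (g ρ)`. -/
theorem lintegral_expNeg_inter (h : R.HasLaw p a μ) (hα : p.alpha = 4) {γ g : ℝ} (hγ : 0 < γ)
    (hg : 0 < g) (j : ℕ) :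
    ∫⁻ ω, expNeg (ENNReal.ofReal (γ / (g * p.rho)) * R.inter p g j ω) ∂μ =
      expNeg (ENNReal.ofReal (a * p.lamA) *
        (ENNReal.ofReal p.lamB⁻¹ * ENNReal.ofReal (√γ * Real.arctan (√γ)))) := by
  have hρ := p.rho_pos
  let X : Ω → ℕ∞ × (ℕ → Plane) := fun ω => (R.K j ω, fun i => R.loc j i ω)
  let M : ℕ → Ω → ℝ × ℝ := fun i ω => (R.linkDist j i ω, R.interGain j i ω)
  let term : ℕ → ℕ∞ × (ℕ → Plane) → ℝ × ℝ → ℝ≥0∞ := fun i x m =>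
    if (i : ℕ∞) < x.1 ∧ m.1 < ‖x.2 i‖ then ENNReal.ofReal (γ * m.1 ^ 4 / ‖x.2 i‖ ^ 4 * m.2) else 0
  let G : Plane → ℝ≥0∞ := fun x => ∫⁻ ω, interLaplace γ ‖x‖ (R.linkDist j 0 ω) ∂μ
  have hterm (i : ℕ) : Measurable (Function.uncurry (term i)) := by
    refine Measurable.ite ?_ (by fun_prop) measurable_const
    refine MeasurableSet.inter ?_ (measurableSet_lt
      (show Measurable fun z : (ℕ∞ × (ℕ → Plane)) × (ℝ × ℝ) => z.2.1 by fun_prop)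
      (show Measurable fun z : (ℕ∞ × (ℕ → Plane)) × (ℝ × ℝ) => ‖z.1.2 i‖ by fun_prop))
    exact (show Measurable fun z : (ℕ∞ × (ℕ → Plane)) × (ℝ × ℝ) => z.1.1 by fun_prop)
      (DiscreteMeasurableSpace.forall_measurableSet {k : ℕ∞ | (i : ℕ∞) < k})
  have hRm := measurable_linkDist (h.measurable_bs j 0)
  have hGm : Measurable G := by
    refine Measurable.lintegral_prod_right'
      (f := fun z : Plane × Ω => interLaplace γ ‖z.1‖ (R.linkDist j 0 z.2)) ?_
    exact (measurable_interLaplace γ).comp (g := fun z : ℝ × ℝ => interLaplace γ z.1 z.2)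
      (f := fun z : Plane × Ω => (‖z.1‖, R.linkDist j 0 z.2)) (by fun_prop)
  have hG1 (x : Plane) : G x ≤ 1 :=
    (lintegral_mono fun ω => interLaplace_le_one hγ _ _).trans (by simp)
  have hv : Measurable fun x => negLog (G x) := measurable_negLog.comp hGm
  -- The factor γ/(gρ) cancels the power level and the target power, leaving γ r⁴/d⁴ times the
  -- fading gain.
  have hscale (ω : Ω) : ENNReal.ofReal (γ / (g * p.rho)) * R.inter p g j ω =
      ∑' i, term i (X ω) (M i ω) := by
    rw [inter, ← ENNReal.tsum_mul_left]
    refine tsum_congr fun i => ?_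
    simp only [term, X, M, mul_ite, mul_zero, transmitPower, hα]
    refine if_congr Iff.rfl ?_ rfl
    rw [← ENNReal.ofReal_mul (by positivity)]
    congr 1
    rw [Real.rpow_neg (norm_nonneg _)]
    norm_cast
    field_simp
  have hXs : Measurable[R.sigmaOf {Source.field j}] X :=
    (measurable_K_sigmaOf (Set.mem_singleton _)).prodMk ((@measurable_pi_iff _ _ _
      (R.sigmaOf _) _ _).2 fun i => measurable_loc_sigmaOf (Set.mem_singleton _) i)
  have hMs (i : ℕ) : Measurable[R.sigmaOf {Source.bs j i, Source.interGain j i}] (M i) :=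
    (measurable_nearestDist.comp (measurable_bs_sigmaOf (by simp))).prodMk
      (measurable_interGain_sigmaOf (by simp))
  have hX : Measurable X := hXs.mono (h.sigmaOf_le _) le_rfl
  have hM (i : ℕ) : Measurable (M i) := (hMs i).mono (h.sigmaOf_le _) le_rfl
  have hmark (i : ℕ) (ω : Ω) : ∫⁻ ω', expNeg (term i (X ω) (M i ω')) ∂μ =
      expNeg (if (i : ℕ∞) < R.K j ω then negLog (G (R.loc j i ω)) else 0) := by
    by_cases hK : (i : ℕ∞) < R.K j ω
    · simp only [term, X, M, hK, true_and, if_true]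
      rw [expNeg_negLog (hG1 _), h.lintegral_mark hγ]
    · simp [term, X, hK]
  -- Given the field, the marks of distinct points are independent, so each is replaced by its mean
  -- `G`; finite sums first, then bounded convergence.
  have hfin (n : ℕ) : ∫⁻ ω, expNeg (∑ i ∈ Finset.range n, term i (X ω) (M i ω)) ∂μ =
      ∫⁻ ω, expNeg (∑ i ∈ Finset.range n,
        if (i : ℕ∞) < R.K j ω then negLog (G (R.loc j i ω)) else 0) ∂μ := by
    have := h.lintegral_prod_marks (S := {Source.field j})
      (U := fun i => {Source.bs j i, Source.interGain j i}) (by simp)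
      (fun i k hik => by simp [hik.symm]) hXs hMs
      (φ := fun i x m => expNeg (term i x m)) (fun i => measurable_expNeg.comp (hterm i)) n
      (H := fun _ => 1) measurable_const
    simp only [one_mul, hmark] at this
    simp_rw [expNeg_sum]
    exact this
  have hL := tendsto_lintegral_expNeg (μ := μ)
    (f := fun n ω => ∑ i ∈ Finset.range n, term i (X ω) (M i ω))
    (fun n => Finset.measurable_fun_sum _ fun i _ => (hterm i).comp (hX.prodMk (hM i)))
    (fun ω => ENNReal.summable.hasSum.tendsto_sum_nat)
  have hR := tendsto_lintegral_expNeg (μ := μ)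
    (f := fun n ω => ∑ i ∈ Finset.range n,
      if (i : ℕ∞) < R.K j ω then negLog (G (R.loc j i ω)) else 0)
    (fun n => Finset.measurable_fun_sum _ fun i _ => Measurable.ite
      (h.measurable_K j (DiscreteMeasurableSpace.forall_measurableSet {k : ℕ∞ | (i : ℕ∞) < k}))
      (hv.comp (h.measurable_loc j i)) measurable_const)
    (fun ω => ENNReal.summable.hasSum.tendsto_sum_nat)
  simp_rw [hscale]
  rw [tendsto_nhds_unique hL (by simpa only [hfin] using hR)]
  simp_rw [← lintegral_countingMeasure _ _ hv]
  have : SigmaFinite (ENNReal.ofReal (a * p.lamA) • (volume : Measure Plane)) :=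
    inferInstanceAs (SigmaFinite (Real.toNNReal (a * p.lamA) • (volume : Measure Plane)))
  rw [(h.field_law j).laplace hv, lintegral_smul_measure, smul_eq_mul]
  simp_rw [fun x => expNeg_negLog (hG1 x)]
  rw [h.lintegral_plane_one_sub hγ j]

end HasLaw

end Round

/-! ### Conditioning on the number of intra-cell interferers -/

lemma Params.lamA_nonneg (p : Params) : 0 ≤ p.lamA := by
  have := p.pa_nonneg
  have := p.lamD_pos
  unfold lamA
  positivity

lemma theta_pos (p : Params) (A g : ℝ) (n : ℕ) : 0 < theta p A g n := by
  have := p.gammaTh_pos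
  unfold theta
  positivity

lemma pmfO_nonneg {p : Params} {a : ℝ} (ha : 0 ≤ a) (n : ℕ) : 0 ≤ pmfO p a n := by
  have hB := p.lamB_pos
  have hA := p.lamA_nonneg
  have hc : 0 < voronoiC := by norm_num [voronoiC]
  have h1 := Real.Gamma_pos_of_pos (show 0 < n + voronoiC + 1 by positivity)
  have h2 := Real.Gamma_pos_of_pos (show 0 < voronoiC + 1 by positivity)
  have h3 := Real.Gamma_pos_of_pos (show 0 < (n : ℝ) + 1 by positivity)
  unfold pmfO
  positivity

namespace Round

section

variable {Ω : Type*}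

/-- Freezing the random range of the intra-cell sum removes the dependence of the reception event on
the cell source. -/
lemma received_inter_N (R : Round Ω) (p : Params) (g : ℝ) (j n : ℕ) :
    R.N ⁻¹' {n} ∩ R.received p g j = R.N ⁻¹' {n} ∩ R.receivedOf p g j n := by
  ext ω
  refine and_congr_right fun (hω : R.N ω = n) => ?_
  rw [mem_received_iff, hω]

lemma noCollision_inter_N (R : Round Ω) (p : Params) (g : ℝ) (n : ℕ) :
    R.N ⁻¹' {n} ∩ R.noCollision p g =
      R.N ⁻¹' {n} ∩ ⋂ j ∈ Finset.Icc 1 n, (R.receivedOf p g j n)ᶜ := by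
  ext ω
  refine and_congr_right fun (hω : R.N ω = n) => ?_
  simp [noCollision, mem_received_iff, hω]

/-- A single intersection with one event per reception is the form to which `measure_inter_biInter`
applies. -/
lemma access_inter_N (R : Round Ω) (p : Params) (g : ℝ) (n : ℕ) :
    R.N ⁻¹' {n} ∩ R.access p g = R.N ⁻¹' {n} ∩ ⋂ j ∈ insert 0 (Finset.Icc 1 n),
      if j = 0 then R.receivedOf p g j n else (R.receivedOf p g j n)ᶜ := by
  have h1 : (⋂ j ∈ Finset.Icc 1 n, if j = 0 then R.receivedOf p g j n
      else (R.receivedOf p g j n)ᶜ) = ⋂ j ∈ Finset.Icc 1 n, (R.receivedOf p g j n)ᶜ :=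
    Set.iInter₂_congr fun j hj => if_neg (by have := (Finset.mem_Icc.1 hj).1; omega)
  rw [access, Finset.set_biInter_insert, if_pos rfl, h1, Set.inter_inter_distrib_left,
    received_inter_N, noCollision_inter_N, ← Set.inter_inter_distrib_left]

lemma disjoint_cell_reception (j : ℕ) :
    Disjoint {Source.cell} {s : Source | s.reception = some j} := by
  simp [Source.reception]

lemma measurableSet_N (R : Round Ω) (n : ℕ) :
    MeasurableSet[R.sigmaOf {Source.cell}] (R.N ⁻¹' {n}) :=
  measurable_N_sigmaOf (Set.mem_singleton _) (measurableSet_singleton n)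

end

namespace HasLaw

variable {Ω : Type*} [MeasurableSpace Ω] {μ : Measure Ω}
  {R : Round Ω} {p : Params} {a : ℝ}

/-- The law of the number of intra-cell interferers. -/
lemma measure_N_eq (h : R.HasLaw p a μ) (ha : 0 ≤ a) (n : ℕ) :
    μ (R.N ⁻¹' {n}) = ENNReal.ofReal (pmfO p a n) := by
  have hB := p.lamB_pos
  have hA := p.lamA_nonneg
  have hmeas (t : ℝ) : Measurable fun x : ℝ => poissonMeasure (Real.toNNReal (t * x)) {n} := by
    simp_rw [poissonMeasure_singleton]
    fun_prop
  have hc : 0 < voronoiC := by norm_num [voronoiC]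
  have h1 := h.count_law Set.univ MeasurableSet.univ n
  rw [Set.preimage_univ, Set.univ_inter, setLIntegral_univ,
    lintegral_map (hmeas _) h.measurable_area] at h1
  -- The gamma law is that of λ_B times the area, so the Poisson mean is aλ_a/λ_B times the
  -- normalized area.
  rw [h1, pmfO, ← lintegral_poissonMeasure_sizeBiased_gamma hc (by positivity), ← h.area_law,
    lintegral_map (hmeas _) (h.measurable_area.const_mul _)]
  refine lintegral_congr fun ω => ?_
  congr 3
  field_simp

lemma real_N_eq (h : R.HasLaw p a μ) (ha : 0 ≤ a) (n : ℕ) :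
    μ.real (R.N ⁻¹' {n}) = pmfO p a n := by
  rw [measureReal_def, h.measure_N_eq ha, ENNReal.toReal_ofReal (pmfO_nonneg ha n)]

variable [IsProbabilityMeasure μ]

/-- Average of a function that is independent of the gains of the intra-cell interferers of
UE `j`, weighted by the Laplace transform of the intra-cell interference. -/
lemma lintegral_intra_mul (h : R.HasLaw p a μ) {γ : ℝ} (hγ : 0 < γ) {S : Set Source} {j : ℕ}
    (hS : ∀ k, Source.gain j k ∉ S) {Z : Ω → ℝ≥0∞} (hZ : Measurable[R.sigmaOf S] Z) {n : ℕ}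
    (hj : j ≤ n) :
    ∫⁻ ω, Z ω * ∏ k ∈ (Finset.range (n + 1)).erase j,
        expNeg (ENNReal.ofReal (γ * R.gain j k ω)) ∂μ =
      (∫⁻ ω, Z ω ∂μ) * ENNReal.ofReal (1 + γ)⁻¹ ^ n := by
  have hj' : j ∈ Finset.range (n + 1) := Finset.mem_range.2 (by omega)
  have key := h.lintegral_prod_marks (S := S) (U := fun k => {Source.gain j k})
    (by simpa using hS) (fun i k hik => by simpa using hik) hZ
    (fun k => measurable_gain_sigmaOf (Set.mem_singleton _))
    -- The factor 1 at `k = j` removes the useful signal from the full range, leaving `n`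
    -- interfering gains.
    (φ := fun k _ x => if k = j then 1 else expNeg (ENNReal.ofReal (γ * x)))
    (fun k => by by_cases hk : k = j <;> simp only [hk, if_true, if_false] <;> fun_prop) (n + 1)
    (H := id) measurable_id
  have hprod (f : ℕ → ℝ≥0∞) : ∏ k ∈ Finset.range (n + 1), (if k = j then 1 else f k) =
      ∏ k ∈ (Finset.range (n + 1)).erase j, f k := by
    rw [← Finset.mul_prod_erase _ _ hj', if_pos rfl, one_mul]
    exact Finset.prod_congr rfl fun k hk => if_neg (Finset.ne_of_mem_erase hk)
  have hmean (k : ℕ) : ∫⁻ ω, (if k = j then 1 else expNeg (ENNReal.ofReal (γ * R.gain j k ω))) ∂μ =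
      if k = j then 1 else ENNReal.ofReal (1 + γ)⁻¹ := by
    split_ifs
    · simp
    · rw [← lintegral_expNeg_expMeasure hγ.le, ← h.gain_law j k,
        lintegral_map (by fun_prop) (h.measurable_gain j k)]
  have hZ' : Measurable Z := hZ.mono (h.sigmaOf_le _) le_rfl
  simp only [id, hmean, hprod, Finset.prod_const, Finset.card_erase_of_mem hj',
    Finset.card_range, Nat.add_sub_cancel] at key
  rw [key, lintegral_mul_const _ hZ']

/-- The success probability of the transmission of UE `j`, with `n` interferers in the cell. -/
theorem measure_receivedOf (h : R.HasLaw p a μ) (hα : p.alpha = 4) (ha : 0 ≤ a) {g : ℝ}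
    (hg : 0 < g) {j n : ℕ} (hj : j ≤ n) :
    μ (R.receivedOf p g j n) = ENNReal.ofReal (theta p a g n) := by
  have hρ := p.rho_pos
  have hγ := p.gammaTh_pos
  have hσ := p.sigmaSq_nonneg
  have hB := p.lamB_pos
  have hA := p.lamA_nonneg
  set γ := p.gammaTh
  set S : Set Source := {s | s.reception = some j ∧ ∀ k, s ≠ Source.gain j k}
  -- `T` is the threshold that the gain of UE `j` must reach: interference plus noise, multiplied by
  -- γ/(gρ). `W` is its part without intra-cell gains.
  let W : Ω → ℝ≥0∞ := fun ω => ENNReal.ofReal (γ / (g * p.rho)) * R.inter p g j ω +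
    ENNReal.ofReal (γ * p.sigmaSq / (g * p.rho))
  let T : Ω → ℝ≥0∞ := fun ω =>
    ∑ k ∈ (Finset.range (n + 1)).erase j, ENNReal.ofReal (γ * R.gain j k ω) + W ω
  have hinterS : Measurable[R.sigmaOf S] (R.inter p g j) :=
    measurable_inter_sigmaOf p g ⟨rfl, by simp⟩ (fun i => ⟨rfl, by simp⟩) (fun i => ⟨rfl, by simp⟩)
  have hWS : Measurable[R.sigmaOf S] W :=
    Measurable.add_const (Measurable.const_mul hinterS _) _
  have hTS : Measurable[R.sigmaOf {s | s.reception = some j ∧ s ≠ Source.gain j j}] T := by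
    refine Measurable.add (Finset.measurable_fun_sum _ fun k hk => ?_)
      (hWS.mono (sigmaOf_mono fun s hs => ⟨hs.1, hs.2 j⟩) le_rfl)
    have hkj : k ≠ j := Finset.ne_of_mem_erase hk
    exact ENNReal.measurable_ofReal.comp (measurable_const.mul
      (measurable_gain_sigmaOf ⟨rfl, by simpa using hkj⟩))
  have hgain : Measurable[R.sigmaOf {Source.gain j j}] (R.gain j j) :=
    measurable_gain_sigmaOf (Set.mem_singleton _)
  -- A positive signal excludes the quotient 0/0, which is 0 in `[0, ∞]` and would break the
  -- equivalence when noise and interference vanish.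
  have hpos : ∀ᵐ ω ∂μ, 0 < R.gain j j ω := by
    have := ae_pos_expMeasure
    rw [← h.gain_law j j] at this
    exact ae_of_ae_map (h.measurable_gain j j).aemeasurable this
  have hiff (ω : Ω) (hω : 0 < R.gain j j ω) :
      ω ∈ R.receivedOf p g j n ↔ T ω ≤ ENNReal.ofReal (R.gain j j ω) := by
    have hs0 : ENNReal.ofReal (g * p.rho) ≠ 0 := by simpa using mul_pos hg hρ
    have hT : ENNReal.ofReal (g * p.rho) * T ω = ENNReal.ofReal γ *
        (∑ k ∈ (Finset.range (n + 1)).erase j, ENNReal.ofReal (g * p.rho * R.gain j k ω) +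
          R.inter p g j ω + ENNReal.ofReal p.sigmaSq) := by
      have e1 : ENNReal.ofReal (g * p.rho) * ENNReal.ofReal (γ / (g * p.rho)) =
          ENNReal.ofReal γ := by
        rw [← ENNReal.ofReal_mul (by positivity)]
        congr 1
        field_simp
      have e2 : ENNReal.ofReal (g * p.rho) * ENNReal.ofReal (γ * p.sigmaSq / (g * p.rho)) =
          ENNReal.ofReal γ * ENNReal.ofReal p.sigmaSq := by
        rw [← ENNReal.ofReal_mul (by positivity), ← ENNReal.ofReal_mul (by positivity)]
        congr 1
        field_simp
      have e3 (k : ℕ) : ENNReal.ofReal (g * p.rho) * ENNReal.ofReal (γ * R.gain j k ω) =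
          ENNReal.ofReal γ * ENNReal.ofReal (g * p.rho * R.gain j k ω) := by
        rw [← ENNReal.ofReal_mul (by positivity), ← ENNReal.ofReal_mul (by positivity)]
        congr 1
        ring
      simp only [T, W, mul_add, Finset.mul_sum, ← mul_assoc, e1, e2, e3, add_assoc]
    have hsig : ENNReal.ofReal (g * p.rho * R.gain j j ω) ≠ 0 := by
      simpa using mul_pos (mul_pos hg hρ) hω
    change ENNReal.ofReal γ ≤ _ / _ ↔ _
    rw [ENNReal.le_div_iff_mul_le (Or.inr hsig) (Or.inr ENNReal.ofReal_ne_top), ← hT,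
      ENNReal.ofReal_mul (mul_pos hg hρ).le, ENNReal.mul_le_mul_iff_right hs0 ENNReal.ofReal_ne_top]
  have htail (t : ℝ≥0∞) : ∫⁻ ω, {x : ℝ | t ≤ ENNReal.ofReal x}.indicator 1 (R.gain j j ω) ∂μ =
      expNeg t := by
    have hms : MeasurableSet {x : ℝ | t ≤ ENNReal.ofReal x} :=
      measurableSet_le measurable_const ENNReal.measurable_ofReal
    rw [← lintegral_map (measurable_one.indicator hms) (h.measurable_gain j j), h.gain_law,
      lintegral_indicator_one hms, expMeasure_ofReal_ge]
  have hF : Measurable (Function.uncurry fun (t : ℝ≥0∞) (x : ℝ) =>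
      {x : ℝ | t ≤ ENNReal.ofReal x}.indicator (1 : ℝ → ℝ≥0∞) x) := by
    have : MeasurableSet {z : ℝ≥0∞ × ℝ | z.1 ≤ ENNReal.ofReal z.2} :=
      measurableSet_le measurable_fst (by fun_prop)
    exact (measurable_one (α := ℝ≥0∞)).indicator this
  have hdisj : Disjoint {s : Source | s.reception = some j ∧ s ≠ Source.gain j j}
      {Source.gain j j} := by simp
  have hstep := h.lintegral_of_disjoint hdisj hTS hgain hF
  simp_rw [htail] at hstep
  have hleft : μ (R.receivedOf p g j n) =
      ∫⁻ ω, {x : ℝ | T ω ≤ ENNReal.ofReal x}.indicator 1 (R.gain j j ω) ∂μ := by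
    rw [← lintegral_indicator_one (h.measurableSet_receivedOf g j n)]
    refine lintegral_congr_ae ?_
    filter_upwards [hpos] with ω hω
    by_cases hmem : ω ∈ R.receivedOf p g j n
    · rw [Set.indicator_of_mem hmem, Set.indicator_of_mem
        (s := {x : ℝ | T ω ≤ ENNReal.ofReal x}) ((hiff ω hω).1 hmem)]
      rfl
    · rw [Set.indicator_of_notMem hmem, Set.indicator_of_notMem
        (s := {x : ℝ | T ω ≤ ENNReal.ofReal x}) fun hc => hmem ((hiff ω hω).2 hc)]
  have hexp (ω : Ω) : expNeg (T ω) = expNeg (W ω) * ∏ k ∈ (Finset.range (n + 1)).erase j,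
      expNeg (ENNReal.ofReal (γ * R.gain j k ω)) := by
    rw [expNeg_add, expNeg_sum, mul_comm]
  have hinter : Measurable (R.inter p g j) := hinterS.mono (h.sigmaOf_le _) le_rfl
  rw [hleft, hstep]
  simp_rw [hexp]
  rw [h.lintegral_intra_mul hγ (S := S) (Z := fun ω => expNeg (W ω)) (fun k hk => hk.2 k rfl)
    (measurable_expNeg.comp hWS) hj]
  simp only [W, expNeg_add]
  rw [lintegral_mul_const _ (by fun_prop), h.lintegral_expNeg_inter hα hγ hg,
    ← ENNReal.ofReal_mul (by positivity), ← ENNReal.ofReal_mul (by positivity),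
    expNeg_ofReal (by positivity), expNeg_ofReal (by positivity),
    ← ENNReal.ofReal_mul (by positivity), ← ENNReal.ofReal_pow (by positivity),
    ← ENNReal.ofReal_mul (by positivity), theta, zpow_neg, zpow_natCast, inv_pow]
  congr 1
  rw [mul_comm (Real.exp _) (Real.exp (-(γ * p.sigmaSq / (g * p.rho)))), mul_right_comm]
  congr 3
  ring

lemma theta_le_one (h : R.HasLaw p a μ) (hα : p.alpha = 4) (ha : 0 ≤ a) {g : ℝ}
    (hg : 0 < g) (n : ℕ) : theta p a g n ≤ 1 := by
  rw [← ENNReal.ofReal_le_one, ← h.measure_receivedOf hα ha hg n.zero_le]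
  exact prob_le_one

lemma measure_compl_receivedOf (h : R.HasLaw p a μ) (hα : p.alpha = 4) (ha : 0 ≤ a) {g : ℝ}
    (hg : 0 < g) {j n : ℕ} (hj : j ≤ n) :
    μ (R.receivedOf p g j n)ᶜ = ENNReal.ofReal (1 - theta p a g n) := by
  rw [prob_compl_eq_one_sub (h.measurableSet_receivedOf g j n), h.measure_receivedOf hα ha hg hj,
    ENNReal.ofReal_sub _ (theta_pos p a g n).le, ENNReal.ofReal_one]

lemma measure_N_inter_received (h : R.HasLaw p a μ) (hα : p.alpha = 4) (ha : 0 ≤ a) {g : ℝ}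
    (hg : 0 < g) (n : ℕ) :
    μ (R.N ⁻¹' {n} ∩ R.received p g 0) = μ (R.N ⁻¹' {n}) * ENNReal.ofReal (theta p a g n) := by
  have := h.measure_inter_biInter (measurableSet_N R n)
    (measurableSet_receivedOf_sigmaOf p g · n) {0} fun j _ => disjoint_cell_reception j
  simpa [received_inter_N, h.measure_receivedOf hα ha hg n.zero_le] using this

lemma measure_N_inter_noCollision (h : R.HasLaw p a μ) (hα : p.alpha = 4) (ha : 0 ≤ a) {g : ℝ}
    (hg : 0 < g) (n : ℕ) :
    μ (R.N ⁻¹' {n} ∩ R.noCollision p g) =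
      μ (R.N ⁻¹' {n}) * ENNReal.ofReal (1 - theta p a g n) ^ n := by
  rw [noCollision_inter_N, h.measure_inter_biInter (measurableSet_N R n)
    (fun j => (measurableSet_receivedOf_sigmaOf p g j n).compl) (Finset.Icc 1 n)
    fun j _ => disjoint_cell_reception j]
  rw [Finset.prod_congr rfl fun j hj =>
    h.measure_compl_receivedOf hα ha hg (Finset.mem_Icc.1 hj).2]
  simp

lemma measure_N_inter_access (h : R.HasLaw p a μ) (hα : p.alpha = 4) (ha : 0 ≤ a) {g : ℝ}
    (hg : 0 < g) (n : ℕ) :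
    μ (R.N ⁻¹' {n} ∩ R.access p g) = μ (R.N ⁻¹' {n}) * (ENNReal.ofReal (theta p a g n) *
      ENNReal.ofReal (1 - theta p a g n) ^ n) := by
  rw [access_inter_N, h.measure_inter_biInter (measurableSet_N R n)
    (B := fun j => if j = 0 then R.receivedOf p g j n else (R.receivedOf p g j n)ᶜ)
    (fun j => by
      split_ifs
      · exact measurableSet_receivedOf_sigmaOf p g j n
      · exact (measurableSet_receivedOf_sigmaOf p g j n).compl) _
    fun j _ => disjoint_cell_reception j, Finset.prod_insert (by simp), if_pos rfl,
    h.measure_receivedOf hα ha hg n.zero_le]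
  rw [Finset.prod_congr rfl fun j hj => by
    rw [if_neg (by have := (Finset.mem_Icc.1 hj).1; omega),
      h.measure_compl_receivedOf hα ha hg (Finset.mem_Icc.1 hj).2]]
  simp

lemma cond_N_real (h : R.HasLaw p a μ) {n : ℕ} (hn : μ (R.N ⁻¹' {n}) ≠ 0) {E : Set Ω} {t : ℝ≥0∞}
    (hE : μ (R.N ⁻¹' {n} ∩ E) = μ (R.N ⁻¹' {n}) * t) :
    (μ[|R.N ⁻¹' {n}]).real E = t.toReal := by
  rw [measureReal_def, cond_apply (h.measurable_N (measurableSet_singleton n)), hE, ← mul_assoc,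
    ENNReal.inv_mul_cancel hn (measure_ne_top _ _), one_mul]

/-- Total probability over the values of `N`; the bound Θ ≤ 1, valid because Θ is a probability,
lets the factors pass back to the reals. -/
theorem hasSum_access (h : R.HasLaw p a μ) (hα : p.alpha = 4) (ha : 0 ≤ a) {g : ℝ}
    (hg : 0 < g) :
    HasSum (fun n => pmfO p a n * theta p a g n * (1 - theta p a g n) ^ n)
      (μ.real (R.access p g)) := by
  have hmeas (n : ℕ) : MeasurableSet (R.N ⁻¹' {n} ∩ R.access p g) := by
    rw [access_inter_N]
    refine (h.measurable_N (measurableSet_singleton n)).inter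
      (Finset.measurableSet_biInter _ fun j _ => ?_)
    split_ifs
    · exact h.measurableSet_receivedOf g j n
    · exact (h.measurableSet_receivedOf g j n).compl
  have hU : R.access p g = ⋃ n, R.N ⁻¹' {n} ∩ R.access p g := by
    ext ω
    simp
  have hd : Pairwise (Function.onFun Disjoint fun n => R.N ⁻¹' {n} ∩ R.access p g) := by
    intro i j hij
    refine Set.disjoint_left.2 fun ω h1 h2 => hij ?_
    exact (h1.1 : R.N ω = i).symm.trans h2.1
  have hs : HasSum (fun n => μ.real (R.N ⁻¹' {n} ∩ R.access p g)) (μ.real (R.access p g)) := by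
    have htsum : ∑' n, μ (R.N ⁻¹' {n} ∩ R.access p g) = μ (R.access p g) := by
      rw [← measure_iUnion hd hmeas, ← hU]
    rw [measureReal_def, ← htsum, ENNReal.tsum_toReal_eq fun n => measure_ne_top _ _]
    exact ENNReal.hasSum_toReal (htsum ▸ measure_ne_top _ _)
  convert hs using 2 with n
  rw [measureReal_def, h.measure_N_inter_access hα ha hg, ENNReal.toReal_mul, ← measureReal_def,
    h.real_N_eq ha, ENNReal.toReal_mul, ENNReal.toReal_pow,
    ENNReal.toReal_ofReal (theta_pos p a g n).le,
    ENNReal.toReal_ofReal (sub_nonneg.2 (h.theta_le_one hα ha hg n)), mul_assoc]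

end HasLaw

end Round

/-! ### Activity probabilities and conclusion -/

lemma activeProb_nonneg {P : ℕ → ℝ} (h1 : ∀ m, P m ≤ 1) (m : ℕ) :
    0 ≤ activeProb P m := by
  rcases Nat.eq_zero_or_pos m with rfl | hm
  · rw [activeProb_eq]
    simp
  induction m, hm using Nat.le_induction with
  | base =>
    rw [activeProb_eq]
    simp
  | succ m hm ih =>
    -- The defining sum telescopes: staying active means being active and then failing.
    have : activeProb P (m + 1) = activeProb P m * (1 - P m) := by
      rw [activeProb_eq, Finset.sum_Ico_succ_top hm]
      linarith [activeProb_eq P m]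
    rw [this]
    exact mul_nonneg ih (sub_nonneg.2 (h1 m))

end GrantFree

theorem lemma1 {Ω : Type*} [MeasurableSpace Ω] (μ : Measure Ω) [IsProbabilityMeasure μ]
    (p : GrantFree.Params) (hα : p.alpha = 4) (rounds : ℕ → GrantFree.Round Ω)
    (hrounds : GrantFree.IsReactive μ p rounds) (m : ℕ) (hm : 1 ≤ m) :
    -- part I: the number of intra-cell interfering UEs
    (∀ n : ℕ, μ.real ((rounds m).N ⁻¹' {n}) =
      GrantFree.pmfO p (GrantFree.reacActive μ p rounds m) n) ∧
    -- part II: transmission success of the typical UE, given `N = n`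
    (∀ n : ℕ, μ ((rounds m).N ⁻¹' {n}) ≠ 0 →
      (μ[|(rounds m).N ⁻¹' {n}]).real ((rounds m).received p (p.g m) 0) =
        GrantFree.theta p (GrantFree.reacActive μ p rounds m) (p.g m) n) ∧
    -- part III: no collision, given `N = n`
    (∀ n : ℕ, μ ((rounds m).N ⁻¹' {n}) ≠ 0 →
      (μ[|(rounds m).N ⁻¹' {n}]).real ((rounds m).noCollision p (p.g m)) =
        (1 - GrantFree.theta p (GrantFree.reacActive μ p rounds m) (p.g m) n) ^ n) ∧
    -- the access success probability
    HasSum (fun n : ℕ =>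
        GrantFree.pmfO p (GrantFree.reacActive μ p rounds m) n *
          GrantFree.theta p (GrantFree.reacActive μ p rounds m) (p.g m) n *
          (1 - GrantFree.theta p (GrantFree.reacActive μ p rounds m) (p.g m) n) ^ n)
      (GrantFree.accessProb μ p rounds m) := by
  have h := hrounds m hm
  have hg := p.g_pos m hm
  -- Nonnegativity ensures that `Real.toNNReal` and `ENNReal.ofReal` do not truncate the
  -- intensities; it only needs that access probabilities are at most 1.
  have ha : 0 ≤ GrantFree.reacActive μ p rounds m :=
    GrantFree.activeProb_nonneg (fun _ => measureReal_le_one) m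
  refine ⟨h.real_N_eq ha, fun n hn => ?_, fun n hn => ?_, h.hasSum_access hα ha hg⟩
  · rw [h.cond_N_real hn (h.measure_N_inter_received hα ha hg n),
      ENNReal.toReal_ofReal (GrantFree.theta_pos _ _ _ _).le]
  · rw [h.cond_N_real hn (h.measure_N_inter_noCollision hα ha hg n), ENNReal.toReal_pow,
      ENNReal.toReal_ofReal (sub_nonneg.2 (h.theta_le_one hα ha hg n))]
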